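/- **Setting.** All fields are real vector fields on $\Omega=(0,2\pi]^2$, $2\pi$-periodic in each direction. $H$ is the space of mean-free, divergence-free (in the sense of periodic distributions) $L^2$ fields, with $|u|^2=\int_\Omega|u|^2dx$; $V\subset H$ consists of the fields with first weak derivatives in $L^2$, $D(A)\subset V$ of those with second weak derivatives in $L^2$. $\mathbb P$ is the Leray projection (the orthogonal projection of $L^2$ onto $H$), $A=-\mathbb P\Delta$, $B(u,v)=\mathbb P((u\cdot\nabla)v)$, and, for real $N>0$, $P_N$ is the orthogonal projection onto the Fourier wavenumbers $k\in\mathbb Z^2$, $|k|\le N$. For $f\in L^\infty(0,\infty;H)$ write $|f|=\operatorname{ess\,sup}_{t>0}|f(t)|$. Given $\nu>0$, a strong solution of $\frac{du}{dt}+\nu Au+B(u,u)=h$, $u(0)=u_0\in V$, is a function $u\in C([0,T];V)\cap L^2(0,T;D(A))$ with $\frac{du}{dt}\in L^2(0,T;H)$ for all $T>0$, that satisfies the initial condition, and the equation for a.e. $t>0$. **Mutual nudging intertwinement.** For $\nu>0$, $N>0$, $\mu_1,\mu_2\ge0$ with $\mu_1+\mu_2>0$, and $g_1,g_2\in L^\infty(0,\infty;H)$,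 consider $$\frac{dv_1}{dt}+\nu Av_1+B(v_1,v_1)=g_1+\mu_1(P_Nv_2-P_Nv_1),\qquad \frac{dv_2}{dt}+\nu Av_2+B(v_2,v_2)=g_2+\mu_2(P_Nv_1-P_Nv_2).$$ It is *finite-dimensionally assisted self-synchronous* at viscosity $\nu$ if for all such $N,\mu_1,\mu_2$ and all $g_1,g_2$ there is an $N'>0$ such that for all initial data $v_0^1,v_0^2\in V$, the strong solution $(v_1,v_2)$ with these data has the following property: if $|P_{N'}v_1(t)-P_{N'}v_2(t)|\to0$ and $|g_1(t)-g_2(t)|\to0$ as $t\to\infty$, then $|v_1(t)-v_2(t)|\to0$ as $t\to\infty$. **Nudging filter.** For $\nu,N>0$, $\mu\in\mathbb R$ and $f\in L^\infty(0,\infty;H)$, let $(v,u)$ be the strong solution of $$\frac{dv}{dt}+\nu Av+B(v,v)=f-\mu P_Nv+\mu P_Nu,\quad v(0)=v_0,\qquad \frac{du}{dt}+\nu Au+B(u,u)=f,\quad u(0)=u_0.$$ It has the *synchronization property* over a set $S\subset(0,\infty)$ of viscosities if there exist, for each $\nu\in S$, a strictly increasing function $\mu_*=\mu_*(\nu,\cdot):(0,\infty)\to(0,\infty)$,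 independent of $f$, and a number $N_*=N_*(|f|,\nu)>0$, depending continuously on $(|f|,\nu)\in[0,\infty)\times S$, such that $|v(t)-u(t)|\to0$ as $t\to\infty$ for all $\nu\in S$, all $f\in L^\infty(0,\infty;H)$, all $N\ge N_*$, all $\mu\in[\mu_*(\nu,N_*),\mu_*(\nu,N)]$ and all $v_0,u_0\in V$. **Theorem.** Let $S\subset(0,\infty)$ be any set of viscosities (for instance a single one, or all of $(0,\infty)$). If the mutual nudging intertwinement is finite-dimensionally assisted self-synchronous at every viscosity $\nu\in S$, then the nudging filter has the synchronization property over $S$. -/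

import Mathlib

open MeasureTheory Filter Topology

namespace NSE2D

/-! ### Function spaces on the `2π`-periodic square -/

/-- The plane `ℝ²` with its Euclidean norm. -/
abbrev Plane : Type := EuclideanSpace ℝ (Fin 2)

/-- One period cell `Ω = (0, 2π]²`. -/
def cell : Set Plane := {x | ∀ i, x i ∈ Set.Ioc 0 (2 * Real.pi)}

/-- Lebesgue measure on the period cell. -/
noncomputable abbrev cellMeasure : Measure Plane := volume.restrict cell

/-- Square-integrable real vector fields on `Ω`; the norm is `|u| = (∫_Ω |u(x)|² dx)^{1/2}`. -/
abbrev L2Field : Type := Lp Plane 2 cellMeasure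

/-- Test functions: smooth real functions on the plane, `2π`-periodic in each direction. -/
def IsPeriodicTest (φ : Plane → ℝ) : Prop :=
  ContDiff ℝ (⊤ : ℕ∞) φ ∧
    ∀ (i : Fin 2) (x : Plane), φ (x + EuclideanSpace.single i (2 * Real.pi)) = φ x

/-- The classical partial derivative `∂_j φ (x)`. -/
noncomputable def partialDeriv (j : Fin 2) (φ : Plane → ℝ) (x : Plane) : ℝ :=
  fderiv ℝ φ x (EuclideanSpace.single j 1)

/-- The constant fields and the gradients of test functions. A field in `L²` is orthogonal to all
of these if and only if it is mean-free and divergence-free in the sense of periodic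
distributions. -/
def constantsAndGradients : Set L2Field :=
  {w | (∃ c : Plane, w =ᵐ[cellMeasure] fun _ => c) ∨
    ∃ φ : Plane → ℝ, IsPeriodicTest φ ∧ w =ᵐ[cellMeasure] fun x => gradient φ x}

/-- The space `H` of mean-free, divergence-free, periodic `L²` vector fields. -/
noncomputable def H : Submodule ℝ L2Field := (Submodule.span ℝ constantsAndGradients)ᗮ

/-- The Leray projection: the orthogonal projection of `L²` onto `H`. -/
noncomputable def leray : L2Field →L[ℝ] L2Field :=
  (Submodule.span ℝ constantsAndGradients)ᗮ.starProjection

/-- `g` is the weak partial derivative `∂_j u` of `u` in the sense of periodic distributions. -/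
def IsWeakPartial (j : Fin 2) (u g : L2Field) : Prop :=
  ∀ φ : Plane → ℝ, IsPeriodicTest φ →
    ∫ x, partialDeriv j φ x • u x ∂cellMeasure = -∫ x, φ x • g x ∂cellMeasure

open Classical in
/-- The weak partial derivative `∂_j u`, whenever it exists in `L²` (and `0` otherwise). -/
noncomputable def weakPartial (j : Fin 2) (u : L2Field) : L2Field :=
  if h : ∃ g, IsWeakPartial j u g then h.choose else 0

/-- `V`: the fields of `H` whose first weak derivatives are in `L²`. -/
def V : Set L2Field := {u | u ∈ H ∧ ∀ j, ∃ g, IsWeakPartial j u g}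

/-- `D(A)`: the fields of `V` whose second weak derivatives are in `L²`. -/
def domA : Set L2Field := {u | u ∈ V ∧ ∀ i j, ∃ g, IsWeakPartial i (weakPartial j u) g}

/-- The Stokes operator `A u = -ℙ Δ u` (meaningful for `u ∈ D(A)`). -/
noncomputable def stokes (u : L2Field) : L2Field :=
  -leray (∑ j, weakPartial j (weakPartial j u))

open Classical in
/-- `B(u, v) = ℙ ((u · ∇) v)`, whenever `(u · ∇) v` is in `L²` (in particular for
`u, v ∈ D(A)`), and `0` otherwise. -/
noncomputable def bilin (u v : L2Field) : L2Field :=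
  if h : MemLp (fun x => ∑ j, u x j • weakPartial j v x) 2 cellMeasure then
    leray (h.toLp _) else 0

/-- The fields `cos (k · x) c` and `sin (k · x) c` with `k ∈ ℤ²`, `|k| ≤ N` and `c ∈ ℝ²`. -/
def lowModes (N : ℝ) : Set L2Field :=
  {w | ∃ (k : Fin 2 → ℤ) (c : Plane), Real.sqrt (∑ i, (k i : ℝ) ^ 2) ≤ N ∧
    ((w =ᵐ[cellMeasure] fun x => Real.cos (∑ i, (k i : ℝ) * x i) • c) ∨
      (w =ᵐ[cellMeasure] fun x => Real.sin (∑ i, (k i : ℝ) * x i) • c))}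

/-- `P_N`: the orthogonal projection onto the Fourier wavenumbers `|k| ≤ N`, for real `N`. -/
noncomputable def lowProj (N : ℝ) : L2Field →L[ℝ] L2Field :=
  (Submodule.span ℝ (lowModes N)).topologicalClosure.starProjection

/-! ### Strong solutions -/

/-- `f ∈ L^∞(0, ∞; H)`. -/
def IsForce (f : ℝ → L2Field) : Prop :=
  MemLp f ⊤ (volume.restrict (Set.Ioi 0)) ∧ ∀ᵐ t ∂volume.restrict (Set.Ioi (0 : ℝ)), f t ∈ H

/-- `|f| = ess sup_{t > 0} |f(t)|`, the norm of `f` in `L^∞(0, ∞; H)`. -/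
noncomputable def forceNorm (f : ℝ → L2Field) : ℝ :=
  (eLpNorm f ⊤ (volume.restrict (Set.Ioi 0))).toReal

/-- `u` is a global strong solution of `du/dt + ν A u + B(u, u) = h`, `u(0) = u₀`: for all `T > 0`,
`u ∈ C([0,T]; V) ∩ L²(0,T; D(A))` and `du/dt ∈ L²(0,T; H)`, and the equation holds in `H` for almost
every `t > 0`. The function `u'` is the weak derivative `du/dt`. -/
def IsStrongSolution (ν : ℝ) (h : ℝ → L2Field) (u₀ : L2Field) (u : ℝ → L2Field) : Prop :=
  u 0 = u₀ ∧
  (∀ t, 0 ≤ t → u t ∈ V) ∧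
  ContinuousOn u (Set.Ici 0) ∧
  (∀ j, ContinuousOn (fun t => weakPartial j (u t)) (Set.Ici 0)) ∧
  (∀ᵐ t ∂volume.restrict (Set.Ioi (0 : ℝ)), u t ∈ domA) ∧
  (∀ T, 0 < T → MemLp (fun t => stokes (u t)) 2 (volume.restrict (Set.Ioc 0 T))) ∧
  ∃ u' : ℝ → L2Field,
    (∀ T, 0 < T → MemLp u' 2 (volume.restrict (Set.Ioc 0 T))) ∧
    (∀ t, 0 ≤ t → u t = u₀ + ∫ s in (0 : ℝ)..t, u' s) ∧
    ∀ᵐ t ∂volume.restrict (Set.Ioi (0 : ℝ)),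
      u' t + ν • stokes (u t) + bilin (u t) (u t) = h t

/-! ### Intertwinements -/

/-- `v = (v 0, v 1)` is a strong solution of the intertwined Navier–Stokes system
`dv_i/dt + ν A v_i + B(v_i, v_i) = g_i + ∑_j M_{ij} F_j(v_j)`, `v_i(0) = v₀_i`. -/
def IsIntertwinedSolution (ν : ℝ) (M : Matrix (Fin 2) (Fin 2) ℝ) (F : Fin 2 → L2Field → L2Field)
    (g : Fin 2 → ℝ → L2Field) (v₀ : Fin 2 → L2Field) (v : Fin 2 → ℝ → L2Field) : Prop :=
  ∀ i, IsStrongSolution ν (fun t => g i t + ∑ j, M i j • F j (v j t)) (v₀ i) (v i)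

/-- The intertwinement with matrix `M` and functions `F` is finite-dimensionally assisted
self-synchronous: for all external forces there is a cut-off `N > 0`, independent of the initial
data, such that `|P_N v_1 - P_N v_2| → 0` and `|g_1 - g_2| → 0` imply `|v_1 - v_2| → 0`. -/
def IsAssistedSelfSynchronous (ν : ℝ) (M : Matrix (Fin 2) (Fin 2) ℝ)
    (F : Fin 2 → L2Field → L2Field) : Prop :=
  ∀ g : Fin 2 → ℝ → L2Field, (∀ i, IsForce (g i)) →
    ∃ N : ℝ, 0 < N ∧
      ∀ v₀ : Fin 2 → L2Field, (∀ i, v₀ i ∈ V) →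
      ∀ v : Fin 2 → ℝ → L2Field, IsIntertwinedSolution ν M F g v₀ v →
        Tendsto (fun t => ‖lowProj N (v 0 t) - lowProj N (v 1 t)‖) atTop (𝓝 0) →
        Tendsto (fun t => ‖g 0 t - g 1 t‖) atTop (𝓝 0) →
        Tendsto (fun t => ‖v 0 t - v 1 t‖) atTop (𝓝 0)

/-- The intertwining matrix of the mutual nudging intertwinement, whose right-hand sides are
`g_1 + μ₁ (P_N v_2 - P_N v_1)` and `g_2 + μ₂ (P_N v_1 - P_N v_2)`. -/
def mutualMatrix (μ₁ μ₂ : ℝ) : Matrix (Fin 2) (Fin 2) ℝ := !![-μ₁, μ₁; μ₂, -μ₂]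

/-- At viscosity `ν`, the mutual nudging intertwinement is finite-dimensionally assisted
self-synchronous (for all nudging cut-offs `N > 0` and all nudging parameters
`μ₁, μ₂ ≥ 0` that are not both zero). -/
def MutualNudgingAssistedSelfSynchronous (ν : ℝ) : Prop :=
  ∀ N μ₁ μ₂ : ℝ, 0 < N → 0 ≤ μ₁ → 0 ≤ μ₂ → 0 < μ₁ + μ₂ →
    IsAssistedSelfSynchronous ν (mutualMatrix μ₁ μ₂) (fun _ w => lowProj N w)

/-! ### The nudging filter -/

/-- `(v, u)` is the strong solution of the nudging filter:
`dv/dt + ν A v + B(v, v) = f - μ P_N v + μ P_N u`, `v(0) = v₀`, and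
`du/dt + ν A u + B(u, u) = f`, `u(0) = u₀`. -/
def IsNudgingSolution (ν μ N : ℝ) (f : ℝ → L2Field) (v₀ u₀ : L2Field) (v u : ℝ → L2Field) : Prop :=
  IsStrongSolution ν (fun t => f t - μ • lowProj N (v t) + μ • lowProj N (u t)) v₀ v ∧
  IsStrongSolution ν f u₀ u

/-- The synchronization property of the nudging filter over a set `S` of viscosities: there are an
increasing function `μ_*(N)`, independent of `f`, and an `N_* > 0`, depending continuously on
`|f|` and `ν`, such that `|v(t) - u(t)| → 0` for all `N ≥ N_*`, all `μ ∈ [μ_*(N_*), μ_*(N)]` and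
all initial data in `V`. -/
def NudgingSynchronizationProperty (S : Set ℝ) : Prop :=
  ∃ (μStar : ℝ → ℝ → ℝ) (NStar : ℝ → ℝ → ℝ),
    (∀ ν ∈ S, StrictMonoOn (μStar ν) (Set.Ioi 0)) ∧
    (∀ ν ∈ S, ∀ N, 0 < N → 0 < μStar ν N) ∧
    ContinuousOn (fun p : ℝ × ℝ => NStar p.1 p.2) (Set.Ici 0 ×ˢ S) ∧
    (∀ a, 0 ≤ a → ∀ ν ∈ S, 0 < NStar a ν) ∧
    ∀ ν ∈ S, ∀ f : ℝ → L2Field, IsForce f →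
      ∀ N, NStar (forceNorm f) ν ≤ N →
      ∀ μ ∈ Set.Icc (μStar ν (NStar (forceNorm f) ν)) (μStar ν N),
      ∀ v₀ ∈ V, ∀ u₀ ∈ V, ∀ v u : ℝ → L2Field, IsNudgingSolution ν μ N f v₀ u₀ v u →
        Tendsto (fun t => ‖v t - u t‖) atTop (𝓝 0)

end NSE2D

namespace NSE2D
open scoped RealInnerProductSpace

/-! ### Integration over the period cell -/

/-! The proof is a direct energy estimate for `w = v - u`. Testing the difference of the two
equations with `w` gives `d/dt |w|² = -2ν|∇w|² - 2⟨B(v,v) - B(u,u), w⟩ - 2μ|P_N w|²`, and one copy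
of `ν|∇w|²` is spent on each of two tasks. The first is the missing high modes of the damping: the
spectral gap `N²(|w|² - |P_N w|²) ≤ |∇w|²` gives `2μ|w|² ≤ 2μ|P_N w|² + ν|∇w|²` as soon as `2μ ≤
νN²`. The second is the nonlinearity: since `⟨(v·∇)w, w⟩ = 0`, only `⟨(w·∇)u, w⟩` survives, and
Ladyzhenskaya's inequality, Poincaré's inequality and Young's inequality bound its contribution by
`ν|∇w|² + (64/ν)|∇u|²|w|²`. Hence `d/dt |w|² ≤ ((64/ν)|∇u|² - 2μ)|w|²` (`norm_sq_sub_le`). The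
energy inequality for `u` (`integral_gradNorm_sq_le`) bounds the time average of `|∇u|²` by
`4|f|²/ν²`, up to a term that decays like `1/T`, so `w` decays exponentially once `2μ > 256|f|²/ν³`.
With `μ_* = νN²/2`, the upper end of the admissible interval for `μ` is the gap condition, and `N_*
= 1 + 16|f|/ν²` makes the lower end exceed the decay threshold. The calculus behind this rests on
trigonometric fields. The Fourier modes are complete, and the truncations commute with weak
derivatives and converge in `L²`. Integration by parts, the spectral gap, Ladyzhenskaya's inequality
and the cancellation of the trilinear form are therefore checked on trigonometric fields and passed
to the limit. -/

lemma measurableSet_cell : MeasurableSet cell := by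
  have : cell = ⋂ i : Fin 2, (fun x : Plane => x i) ⁻¹' Set.Ioc 0 (2 * Real.pi) := by
    ext x; simp [cell]
  rw [this]
  exact MeasurableSet.iInter fun i => measurableSet_Ioc.preimage (by fun_prop)

lemma cell_subset_closedBall : cell ⊆ Metric.closedBall (0 : Plane) (4 * Real.pi) := by
  intro x hx
  rw [mem_closedBall_zero_iff, EuclideanSpace.norm_eq, Fin.sum_univ_two]
  have hpi := Real.pi_pos
  have h0 := hx 0
  have h1 := hx 1
  simp only [Set.mem_Ioc] at h0 h1
  rw [Real.sqrt_le_left (by positivity)]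
  simp only [Real.norm_eq_abs, sq_abs]
  nlinarith

instance : IsFiniteMeasure cellMeasure := by
  refine ⟨?_⟩
  rw [Measure.restrict_apply_univ]
  exact (measure_mono cell_subset_closedBall).trans_lt
    (isCompact_closedBall (0 : Plane) _).measure_lt_top

lemma exists_bound_on_cell {E : Type*} [NormedAddCommGroup E] {f : Plane → E}
    (hf : Continuous f) : ∃ C, ∀ᵐ x ∂cellMeasure, ‖f x‖ ≤ C := by
  obtain ⟨C, hC⟩ := (isCompact_closedBall (0 : Plane) (4 * Real.pi)).exists_bound_of_continuousOn
    hf.continuousOn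
  exact ⟨C, (ae_restrict_iff' measurableSet_cell).2
    (Eventually.of_forall fun x hx => hC x (cell_subset_closedBall hx))⟩

lemma memLp_of_continuous {E : Type*} [NormedAddCommGroup E] [SecondCountableTopology E]
    {f : Plane → E} (hf : Continuous f) (p : ENNReal) : MemLp f p cellMeasure := by
  borelize E
  obtain ⟨C, hC⟩ := exists_bound_on_cell hf
  exact MemLp.of_bound hf.measurable.aestronglyMeasurable C hC

lemma integrable_of_continuous {E : Type*} [NormedAddCommGroup E] [SecondCountableTopology E]
    {f : Plane → E} (hf : Continuous f) : Integrable f cellMeasure :=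
  memLp_one_iff_integrable.1 (memLp_of_continuous hf 1)

/-- The point with coordinates `(a, b)`. -/
noncomputable def point (p : ℝ × ℝ) : Plane := !₂[p.1, p.2]

lemma continuous_point : Continuous point := by
  unfold point; fun_prop

lemma measurePreserving_point : MeasurePreserving point volume volume := by
  have h1 := (volume_preserving_finTwoArrow ℝ).symm
  exact (PiLp.volume_preserving_toLp (Fin 2)).comp h1

lemma measurableEmbedding_point : MeasurableEmbedding point := by
  have : point = (MeasurableEquiv.toLp 2 (Fin 2 → ℝ)) ∘ (MeasurableEquiv.finTwoArrow (α := ℝ)).symm := by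
    ext p i; rfl
  rw [this]
  exact (MeasurableEquiv.toLp 2 (Fin 2 → ℝ)).measurableEmbedding.comp
    (MeasurableEquiv.finTwoArrow (α := ℝ)).symm.measurableEmbedding

lemma point_preimage_cell :
    point ⁻¹' cell = Set.Ioc 0 (2 * Real.pi) ×ˢ Set.Ioc 0 (2 * Real.pi) := by
  ext p
  simp [cell, point, Fin.forall_fin_two]

lemma measurePreserving_point_cell : MeasurePreserving point
    ((volume.restrict (Set.Ioc 0 (2 * Real.pi))).prod (volume.restrict (Set.Ioc 0 (2 * Real.pi))))
    cellMeasure := by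
  have h := measurePreserving_point.restrict_preimage measurableSet_cell
  rw [point_preimage_cell] at h
  rw [Measure.prod_restrict]
  exact h

lemma setIntegral_cell {E : Type*} [NormedAddCommGroup E] [NormedSpace ℝ E]
    [SecondCountableTopology E] {f : Plane → E} (hf : Continuous f) :
    ∫ x, f x ∂cellMeasure =
      ∫ a in (0 : ℝ)..2 * Real.pi, ∫ b in (0 : ℝ)..2 * Real.pi, f (point (a, b)) := by
  have hpi : (0 : ℝ) ≤ 2 * Real.pi := by positivity
  rw [← measurePreserving_point_cell.integral_comp measurableEmbedding_point, integral_prod]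
  · simp_rw [intervalIntegral.integral_of_le hpi]
  · exact (measurePreserving_point_cell.integrable_comp_emb measurableEmbedding_point).2
      (integrable_of_continuous hf)

lemma setIntegral_cell_swap {E : Type*} [NormedAddCommGroup E] [NormedSpace ℝ E]
    [SecondCountableTopology E] {f : Plane → E} (hf : Continuous f) :
    ∫ x, f x ∂cellMeasure =
      ∫ b in (0 : ℝ)..2 * Real.pi, ∫ a in (0 : ℝ)..2 * Real.pi, f (point (a, b)) := by
  have hpi : (0 : ℝ) ≤ 2 * Real.pi := by positivity
  rw [← measurePreserving_point_cell.integral_comp measurableEmbedding_point, integral_prod_symm]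
  · simp_rw [intervalIntegral.integral_of_le hpi]
  · exact (measurePreserving_point_cell.integrable_comp_emb measurableEmbedding_point).2
      (integrable_of_continuous hf)

/-! ### Smooth periodic functions -/

/-- Smooth functions on the plane, `2π`-periodic in each direction. -/
structure IsPeriodicSmooth {E : Type*} [NormedAddCommGroup E] [NormedSpace ℝ E]
    (φ : Plane → E) : Prop where
  contDiff : ContDiff ℝ (⊤ : ℕ∞) φ
  periodic : ∀ (i : Fin 2) (x : Plane), φ (x + EuclideanSpace.single i (2 * Real.pi)) = φ x

/-- The partial derivative in direction `j` of a function with values in a normed space. -/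
noncomputable def pderiv {E : Type*} [NormedAddCommGroup E] [NormedSpace ℝ E]
    (j : Fin 2) (φ : Plane → E) (x : Plane) : E :=
  fderiv ℝ φ x (EuclideanSpace.single j 1)

section
variable {E : Type*} [NormedAddCommGroup E] [NormedSpace ℝ E] {φ ψ : Plane → E}

lemma IsPeriodicSmooth.differentiable (h : IsPeriodicSmooth φ) : Differentiable ℝ φ :=
  h.contDiff.differentiable (by simp)

lemma IsPeriodicSmooth.continuous (h : IsPeriodicSmooth φ) : Continuous φ :=
  h.contDiff.continuous

lemma IsPeriodicSmooth.pderiv (h : IsPeriodicSmooth φ) (j : Fin 2) :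
    IsPeriodicSmooth (pderiv j φ) := by
  constructor
  · exact (h.contDiff.fderiv_right (m := (⊤ : ℕ∞)) (by norm_cast)).clm_apply contDiff_const
  · intro i x
    have : (fun y => φ (y + EuclideanSpace.single i (2 * Real.pi))) = φ := funext (h.periodic i)
    simp only [NSE2D.pderiv]
    rw [← fderiv_comp_add_right, this]

lemma IsPeriodicSmooth.add (h : IsPeriodicSmooth φ) (h' : IsPeriodicSmooth ψ) :
    IsPeriodicSmooth (φ + ψ) :=
  ⟨h.contDiff.add h'.contDiff, fun i x => by simp [h.periodic, h'.periodic]⟩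

lemma IsPeriodicSmooth.const_smul (h : IsPeriodicSmooth φ) (c : ℝ) :
    IsPeriodicSmooth (c • φ) :=
  ⟨h.contDiff.const_smul c, fun i x => by simp [h.periodic]⟩

lemma IsPeriodicSmooth.smul_const {φ : Plane → ℝ} (h : IsPeriodicSmooth φ) (c : E) :
    IsPeriodicSmooth (fun x => φ x • c) :=
  ⟨h.contDiff.smul contDiff_const, fun i x => by simp [h.periodic]⟩

lemma IsPeriodicSmooth.smul {φ : Plane → ℝ} (h : IsPeriodicSmooth φ) (h' : IsPeriodicSmooth ψ) :
    IsPeriodicSmooth (fun x => φ x • ψ x) :=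
  ⟨h.contDiff.smul h'.contDiff, fun i x => by simp [h.periodic, h'.periodic]⟩

lemma hasDerivAt_point_fst (h : Differentiable ℝ φ) (a b : ℝ) :
    HasDerivAt (fun a => φ (point (a, b))) (pderiv 0 φ (point (a, b))) a := by
  have h1 : HasDerivAt (fun a : ℝ => point (a, b)) (EuclideanSpace.single 0 1) a := by
    have : (fun a : ℝ => point (a, b)) =
        fun a : ℝ => a • EuclideanSpace.single (0 : Fin 2) (1 : ℝ) + point (0, b) := by
      funext a; ext i; fin_cases i <;> simp [point]
    rw [this]
    simpa using ((hasDerivAt_id a).smul_const (EuclideanSpace.single (0 : Fin 2) (1 : ℝ))).add_const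
      (point (0, b))
  exact (h (point (a, b))).hasFDerivAt.comp_hasDerivAt a h1

lemma hasDerivAt_point_snd (h : Differentiable ℝ φ) (a b : ℝ) :
    HasDerivAt (fun b => φ (point (a, b))) (pderiv 1 φ (point (a, b))) b := by
  have h1 : HasDerivAt (fun b : ℝ => point (a, b)) (EuclideanSpace.single 1 1) b := by
    have : (fun b : ℝ => point (a, b)) =
        fun b : ℝ => b • EuclideanSpace.single (1 : Fin 2) (1 : ℝ) + point (a, 0) := by
      funext a; ext i; fin_cases i <;> simp [point]
    rw [this]
    simpa using ((hasDerivAt_id b).smul_const (EuclideanSpace.single (1 : Fin 2) (1 : ℝ))).add_const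
      (point (a, 0))
  exact (h (point (a, b))).hasFDerivAt.comp_hasDerivAt b h1

lemma point_add_fst (a b c : ℝ) : point (a, b) + EuclideanSpace.single 0 c = point (a + c, b) := by
  ext i; fin_cases i <;> simp [point]

lemma point_add_snd (a b c : ℝ) : point (a, b) + EuclideanSpace.single 1 c = point (a, b + c) := by
  ext i; fin_cases i <;> simp [point]

/-- Integrating first in the variable `x_j`, the fundamental theorem of calculus leaves a boundary
difference that periodicity cancels. This is why both orders of iterated integration are available.
-/
lemma integral_pderiv_eq_zero [CompleteSpace E] [SecondCountableTopology E]
    (h : IsPeriodicSmooth φ) (j : Fin 2) : ∫ x, pderiv j φ x ∂cellMeasure = 0 := by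
  have hc := (h.pderiv j).continuous
  have hp := continuous_point
  fin_cases j
  · rw [setIntegral_cell_swap hc]
    have : ∀ b, ∫ a in (0 : ℝ)..2 * Real.pi, pderiv 0 φ (point (a, b)) = 0 := by
      intro b
      rw [intervalIntegral.integral_eq_sub_of_hasDerivAt
        (fun a _ => hasDerivAt_point_fst h.differentiable a b)
        ((hc.comp (hp.comp (by fun_prop : Continuous fun a : ℝ => (a, b)))).intervalIntegrable _ _)]
      have := h.periodic 0 (point (0, b))
      rw [point_add_fst, zero_add] at this
      rw [this, sub_self]
    simp [this]
  · rw [setIntegral_cell hc]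
    have : ∀ a, ∫ b in (0 : ℝ)..2 * Real.pi, pderiv 1 φ (point (a, b)) = 0 := by
      intro a
      rw [intervalIntegral.integral_eq_sub_of_hasDerivAt
        (fun b _ => hasDerivAt_point_snd h.differentiable a b)
        ((hc.comp (hp.comp (by fun_prop : Continuous fun b : ℝ => (a, b)))).intervalIntegrable _ _)]
      have := h.periodic 1 (point (a, 0))
      rw [point_add_snd, zero_add] at this
      rw [this, sub_self]
    simp [this]

lemma integral_pderiv_smul [CompleteSpace E] [SecondCountableTopology E] {φ : Plane → ℝ}
    (h : IsPeriodicSmooth φ) (h' : IsPeriodicSmooth ψ) (j : Fin 2) :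
    ∫ x, pderiv j φ x • ψ x ∂cellMeasure = -∫ x, φ x • pderiv j ψ x ∂cellMeasure := by
  have h0 := integral_pderiv_eq_zero (h.smul h') j
  have h1 : pderiv j (fun x => φ x • ψ x) =
      fun x => φ x • pderiv j ψ x + pderiv j φ x • ψ x := by
    funext x
    simp only [pderiv]
    have := ((h.differentiable x).hasFDerivAt.smul (h'.differentiable x).hasFDerivAt).fderiv
    change fderiv ℝ (φ • ψ) x _ = _
    rw [this]
    simp
  rw [h1] at h0
  refine eq_neg_of_add_eq_zero_right (Eq.trans ?_ h0)
  exact (integral_add (integrable_of_continuous (h.continuous.smul (h'.pderiv j).continuous))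
    (integrable_of_continuous ((h.pderiv j).continuous.smul h'.continuous))).symm

end

lemma isPeriodicSmooth_iff {φ : Plane → ℝ} : IsPeriodicSmooth φ ↔ IsPeriodicTest φ :=
  ⟨fun h => ⟨h.1, h.2⟩, fun h => ⟨h.1, h.2⟩⟩

/-! ### Weak derivatives -/

lemma IsWeakPartial.add {j : Fin 2} {u v g h : L2Field} (hu : IsWeakPartial j u g)
    (hv : IsWeakPartial j v h) : IsWeakPartial j (u + v) (g + h) := by
  intro φ hφ
  have key : ∀ (f : Plane → ℝ), Continuous f → ∀ a b : L2Field,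
      ∫ x, f x • (a + b : L2Field) x ∂cellMeasure =
        ∫ x, f x • a x ∂cellMeasure + ∫ x, f x • b x ∂cellMeasure := by
    intro f hf a b
    have hi : ∀ a : L2Field, Integrable (fun x => f x • a x) cellMeasure := fun a =>
      memLp_one_iff_integrable.1 ((Lp.memLp a).smul (memLp_of_continuous hf 2))
    rw [← integral_add (hi a) (hi b)]
    refine integral_congr_ae ?_
    filter_upwards [Lp.coeFn_add a b] with x hx
    rw [hx, Pi.add_apply, smul_add]
  have hs := isPeriodicSmooth_iff.2 hφ
  rw [key (partialDeriv j φ) (hs.pderiv j).continuous, key _ hs.continuous, hu φ hφ, hv φ hφ]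
  abel

lemma IsWeakPartial.smul {j : Fin 2} {u g : L2Field} (hu : IsWeakPartial j u g) (c : ℝ) :
    IsWeakPartial j (c • u) (c • g) := by
  intro φ hφ
  have key : ∀ (f : Plane → ℝ) (a : L2Field),
      ∫ x, f x • (c • a : L2Field) x ∂cellMeasure = c • ∫ x, f x • a x ∂cellMeasure := by
    intro f a
    rw [← integral_smul]
    refine integral_congr_ae ?_
    filter_upwards [Lp.coeFn_smul c a] with x hx
    rw [hx, Pi.smul_apply, smul_comm]
  rw [key, key, hu φ hφ, smul_neg]

lemma IsWeakPartial.sub {j : Fin 2} {u v g h : L2Field} (hu : IsWeakPartial j u g)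
    (hv : IsWeakPartial j v h) : IsWeakPartial j (u - v) (g - h) := by
  have := hu.add (hv.smul (-1))
  simpa [sub_eq_add_neg] using this

lemma isWeakPartial_zero (j : Fin 2) : IsWeakPartial j 0 0 := by
  intro φ hφ
  have h0 : ∀ f : Plane → ℝ, ∫ x, f x • (0 : L2Field) x ∂cellMeasure = 0 := by
    intro f
    rw [← integral_zero (α := Plane) (G := Plane) (μ := cellMeasure)]
    refine integral_congr_ae ?_
    filter_upwards [Lp.coeFn_zero Plane 2 cellMeasure] with x hx
    rw [hx, Pi.zero_apply, smul_zero]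
  rw [h0, h0, neg_zero]

/-- The `L²` field defined by a continuous field. -/
noncomputable def ofContinuous (φ : Plane → Plane) (hφ : Continuous φ) : L2Field :=
  (memLp_of_continuous hφ 2).toLp φ

lemma coeFn_ofContinuous {φ : Plane → Plane} (hφ : Continuous φ) :
    ofContinuous φ hφ =ᵐ[cellMeasure] φ :=
  MemLp.coeFn_toLp _

lemma isWeakPartial_of_ae_eq {j : Fin 2} {e e' : L2Field} {φ : Plane → Plane}
    (hφ : IsPeriodicSmooth φ) (he : e =ᵐ[cellMeasure] φ) (he' : e' =ᵐ[cellMeasure] pderiv j φ) :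
    IsWeakPartial j e e' := by
  intro ψ hψ
  have h := integral_pderiv_smul (isPeriodicSmooth_iff.2 hψ) hφ j
  have h1 : ∫ x, partialDeriv j ψ x • e x ∂cellMeasure =
      ∫ x, pderiv j ψ x • φ x ∂cellMeasure := by
    refine integral_congr_ae ?_
    filter_upwards [he] with x hx
    rw [hx]; rfl
  have h2 : ∫ x, ψ x • e' x ∂cellMeasure = ∫ x, ψ x • pderiv j φ x ∂cellMeasure := by
    refine integral_congr_ae ?_
    filter_upwards [he'] with x hx
    rw [hx]
  rw [h1, h2, h]

/-- Weak derivatives are defined by testing with scalar functions against vector fields. This form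
of the inner product, one scalar coordinate of `φ` at a time, lets that definition be applied to
vector test fields. -/
lemma inner_of_ae_eq {e u : L2Field} {φ : Plane → Plane} (hφ : Continuous φ)
    (he : e =ᵐ[cellMeasure] φ) :
    ⟪e, u⟫ = ∑ i, (∫ x, φ x i • u x ∂cellMeasure) i := by
  rw [L2.inner_def]
  have hi : ∀ i, Integrable (fun x => φ x i • u x) cellMeasure := fun i =>
    memLp_one_iff_integrable.1 ((Lp.memLp u).smul
      (memLp_of_continuous (f := fun x => φ x i) (by fun_prop) 2))
  have h1 : ∀ i, (∫ x, φ x i • u x ∂cellMeasure) i = ∫ x, φ x i * u x i ∂cellMeasure := by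
    intro i
    have := (EuclideanSpace.proj (𝕜 := ℝ) i).integral_comp_comm (hi i)
    simpa using this.symm
  simp_rw [h1]
  rw [← integral_finsetSum]
  · refine integral_congr_ae ?_
    filter_upwards [he] with x hx
    rw [hx]
    simp [PiLp.inner_apply, mul_comm]
  · intro i _
    simpa using (EuclideanSpace.proj (𝕜 := ℝ) i).integrable_comp (hi i)

/-- The `i`-th coordinate as a continuous linear functional. -/
noncomputable def coord (i : Fin 2) : Plane →L[ℝ] ℝ := EuclideanSpace.proj i

lemma IsPeriodicSmooth.apply {φ : Plane → Plane} (h : IsPeriodicSmooth φ) (i : Fin 2) :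
    IsPeriodicSmooth (fun x => φ x i) :=
  ⟨(coord i).contDiff.comp h.contDiff, fun j x => by rw [h.periodic]⟩

lemma pderiv_apply {φ : Plane → Plane} (h : Differentiable ℝ φ) (i j : Fin 2) (x : Plane) :
    pderiv j (fun x => φ x i) x = pderiv j φ x i := by
  have := ((coord i).hasFDerivAt.comp x (h x).hasFDerivAt).fderiv
  simp only [pderiv]
  change fderiv ℝ (⇑(coord i) ∘ φ) x _ = _
  rw [this]
  rfl

lemma IsWeakPartial.inner_eq {j : Fin 2} {u g e e' : L2Field} {φ : Plane → Plane}
    (h : IsWeakPartial j u g) (hφ : IsPeriodicSmooth φ) (he : e =ᵐ[cellMeasure] φ)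
    (he' : e' =ᵐ[cellMeasure] pderiv j φ) : ⟪e', u⟫ = -⟪e, g⟫ := by
  rw [inner_of_ae_eq (hφ.pderiv j).continuous he', inner_of_ae_eq hφ.continuous he,
    ← Finset.sum_neg_distrib]
  refine Finset.sum_congr rfl fun i _ => ?_
  have := h _ (isPeriodicSmooth_iff.1 (hφ.apply i))
  have h2 : ∀ x, partialDeriv j (fun x => φ x i) x = pderiv j φ x i :=
    pderiv_apply hφ.differentiable i j
  simp_rw [h2] at this
  rw [this]; simp

/-! ### Fourier modes -/

/-- The phase `k · x`. -/
noncomputable def phase (k : Fin 2 → ℤ) : Plane →L[ℝ] ℝ :=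
  ∑ i, (k i : ℝ) • EuclideanSpace.proj i

lemma phase_apply (k : Fin 2 → ℤ) (x : Plane) : phase k x = ∑ i, (k i : ℝ) * x i := by
  simp [phase]

lemma phase_single (k : Fin 2 → ℤ) (i : Fin 2) (a : ℝ) :
    phase k (EuclideanSpace.single i a) = k i * a := by
  rw [phase_apply]
  fin_cases i <;> simp

lemma isPeriodicSmooth_cos (k : Fin 2 → ℤ) : IsPeriodicSmooth fun x => Real.cos (phase k x) := by
  refine ⟨Real.contDiff_cos.comp (phase k).contDiff, fun i x => ?_⟩
  rw [map_add, phase_single, Real.cos_add_int_mul_two_pi]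

lemma isPeriodicSmooth_sin (k : Fin 2 → ℤ) : IsPeriodicSmooth fun x => Real.sin (phase k x) := by
  refine ⟨Real.contDiff_sin.comp (phase k).contDiff, fun i x => ?_⟩
  rw [map_add, phase_single, Real.sin_add_int_mul_two_pi]

/-- The field `cos (k · x) c`. -/
noncomputable def cosMode (k : Fin 2 → ℤ) (c : Plane) : L2Field :=
  ofContinuous (fun x => Real.cos (phase k x) • c) ((isPeriodicSmooth_cos k).smul_const c).continuous

/-- The field `sin (k · x) c`. -/
noncomputable def sinMode (k : Fin 2 → ℤ) (c : Plane) : L2Field :=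
  ofContinuous (fun x => Real.sin (phase k x) • c) ((isPeriodicSmooth_sin k).smul_const c).continuous

lemma pderiv_cos (k : Fin 2 → ℤ) (c : Plane) (j : Fin 2) :
    pderiv j (fun x => Real.cos (phase k x) • c) =
      fun x => (-(k j : ℝ)) • Real.sin (phase k x) • c := by
  funext x
  have := ((phase k).hasFDerivAt (x := x)).cos.smul_const c
  simp only [pderiv]
  rw [this.fderiv]
  simp [phase_single, smul_smul, mul_comm]

lemma pderiv_sin (k : Fin 2 → ℤ) (c : Plane) (j : Fin 2) :
    pderiv j (fun x => Real.sin (phase k x) • c) =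
      fun x => (k j : ℝ) • Real.cos (phase k x) • c := by
  funext x
  have := ((phase k).hasFDerivAt (x := x)).sin.smul_const c
  simp only [pderiv]
  rw [this.fderiv]
  simp [phase_single, smul_smul, mul_comm]

lemma coeFn_cosMode (k : Fin 2 → ℤ) (c : Plane) :
    cosMode k c =ᵐ[cellMeasure] fun x => Real.cos (phase k x) • c := coeFn_ofContinuous _

lemma coeFn_sinMode (k : Fin 2 → ℤ) (c : Plane) :
    sinMode k c =ᵐ[cellMeasure] fun x => Real.sin (phase k x) • c := coeFn_ofContinuous _

lemma coeFn_pderiv_cosMode (k : Fin 2 → ℤ) (c : Plane) (j : Fin 2) :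
    (-(k j : ℝ) • sinMode k c : L2Field) =ᵐ[cellMeasure]
      pderiv j fun x => Real.cos (phase k x) • c := by
  rw [pderiv_cos]
  filter_upwards [Lp.coeFn_smul (-(k j : ℝ)) (sinMode k c), coeFn_sinMode k c] with x h1 h2
  rw [h1, Pi.smul_apply, h2]

lemma coeFn_pderiv_sinMode (k : Fin 2 → ℤ) (c : Plane) (j : Fin 2) :
    ((k j : ℝ) • cosMode k c : L2Field) =ᵐ[cellMeasure]
      pderiv j fun x => Real.sin (phase k x) • c := by
  rw [pderiv_sin]
  filter_upwards [Lp.coeFn_smul ((k j : ℝ)) (cosMode k c), coeFn_cosMode k c] with x h1 h2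
  rw [h1, Pi.smul_apply, h2]

lemma isWeakPartial_cosMode (k : Fin 2 → ℤ) (c : Plane) (j : Fin 2) :
    IsWeakPartial j (cosMode k c) (-(k j : ℝ) • sinMode k c) :=
  isWeakPartial_of_ae_eq ((isPeriodicSmooth_cos k).smul_const c) (coeFn_cosMode k c)
    (coeFn_pderiv_cosMode k c j)

lemma isWeakPartial_sinMode (k : Fin 2 → ℤ) (c : Plane) (j : Fin 2) :
    IsWeakPartial j (sinMode k c) ((k j : ℝ) • cosMode k c) :=
  isWeakPartial_of_ae_eq ((isPeriodicSmooth_sin k).smul_const c) (coeFn_sinMode k c)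
    (coeFn_pderiv_sinMode k c j)

/-- The length `|k|` of a wavenumber. -/
noncomputable def waveLength (k : Fin 2 → ℤ) : ℝ := Real.sqrt (∑ i, (k i : ℝ) ^ 2)

lemma mem_lowModes_iff {N : ℝ} {w : L2Field} :
    w ∈ lowModes N ↔ ∃ k c, waveLength k ≤ N ∧ (w = cosMode k c ∨ w = sinMode k c) := by
  simp only [lowModes, Set.mem_ofPred_eq, waveLength]
  refine exists_congr fun k => exists_congr fun c => and_congr_right fun _ => ?_
  have h1 := coeFn_cosMode k c
  have h2 := coeFn_sinMode k c
  simp only [phase_apply] at h1 h2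
  exact or_congr ⟨fun h => Lp.ext (h.trans h1.symm), fun h => h ▸ h1⟩
    ⟨fun h => Lp.ext (h.trans h2.symm), fun h => h ▸ h2⟩

/-- The trigonometric fields with wavenumbers `|k| ≤ N`. -/
noncomputable def trig (N : ℝ) : Submodule ℝ L2Field := Submodule.span ℝ (lowModes N)

lemma cosMode_mem_trig {N : ℝ} {k : Fin 2 → ℤ} (h : waveLength k ≤ N) (c : Plane) :
    cosMode k c ∈ trig N :=
  Submodule.subset_span (mem_lowModes_iff.2 ⟨k, c, h, Or.inl rfl⟩)

lemma sinMode_mem_trig {N : ℝ} {k : Fin 2 → ℤ} (h : waveLength k ≤ N) (c : Plane) :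
    sinMode k c ∈ trig N :=
  Submodule.subset_span (mem_lowModes_iff.2 ⟨k, c, h, Or.inr rfl⟩)

lemma trig_mono {N M : ℝ} (h : N ≤ M) : trig N ≤ trig M := by
  refine Submodule.span_mono fun w hw => ?_
  obtain ⟨k, c, hk, hw⟩ := mem_lowModes_iff.1 hw
  exact mem_lowModes_iff.2 ⟨k, c, hk.trans h, hw⟩

/-- Differentiation exchanges `cos` and `sin` modes of the same wavenumber, so trigonometric fields
of degree `N` are smooth and their derivatives stay in `trig N`. -/
lemma exists_smooth_of_mem_trig {N : ℝ} {e : L2Field} (he : e ∈ trig N) :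
    ∃ φ : Plane → Plane, IsPeriodicSmooth φ ∧ e =ᵐ[cellMeasure] φ ∧
      ∀ j, ∃ e' ∈ trig N, e' =ᵐ[cellMeasure] pderiv j φ := by
  induction he using Submodule.span_induction with
  | mem w hw =>
    obtain ⟨k, c, hk, rfl | rfl⟩ := mem_lowModes_iff.1 hw
    · exact ⟨_, (isPeriodicSmooth_cos k).smul_const c, coeFn_cosMode k c, fun j =>
        ⟨_, Submodule.smul_mem _ _ (sinMode_mem_trig hk c), coeFn_pderiv_cosMode k c j⟩⟩
    · exact ⟨_, (isPeriodicSmooth_sin k).smul_const c, coeFn_sinMode k c, fun j =>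
        ⟨_, Submodule.smul_mem _ _ (cosMode_mem_trig hk c), coeFn_pderiv_sinMode k c j⟩⟩
  | zero =>
    have h0 : IsPeriodicSmooth (fun _ : Plane => (0 : Plane)) := ⟨contDiff_const, fun _ _ => rfl⟩
    refine ⟨_, h0, Lp.coeFn_zero _ _ _, fun j => ⟨0, zero_mem _, ?_⟩⟩
    refine (Lp.coeFn_zero _ _ _).trans (Eventually.of_forall fun x => ?_)
    simp [pderiv]
  | add a b _ _ ha hb =>
    obtain ⟨φ, hφ, haφ, hφ'⟩ := ha
    obtain ⟨ψ, hψ, hbψ, hψ'⟩ := hb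
    refine ⟨φ + ψ, hφ.add hψ, (Lp.coeFn_add a b).trans (haφ.add hbψ), fun j => ?_⟩
    obtain ⟨a', ha', haj⟩ := hφ' j
    obtain ⟨b', hb', hbj⟩ := hψ' j
    refine ⟨a' + b', add_mem ha' hb', ?_⟩
    filter_upwards [Lp.coeFn_add a' b', haj, hbj] with x h1 h2 h3
    rw [h1, Pi.add_apply, h2, h3]
    simp only [pderiv]
    rw [fderiv_add (hφ.differentiable x) (hψ.differentiable x)]
    rfl
  | smul r a _ ha =>
    obtain ⟨φ, hφ, haφ, hφ'⟩ := ha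
    refine ⟨r • φ, hφ.const_smul r, (Lp.coeFn_smul r a).trans (haφ.const_smul r), fun j => ?_⟩
    obtain ⟨a', ha', haj⟩ := hφ' j
    refine ⟨r • a', Submodule.smul_mem _ _ ha', ?_⟩
    filter_upwards [Lp.coeFn_smul r a', haj] with x h1 h2
    rw [h1, Pi.smul_apply, h2]
    simp only [pderiv]
    rw [fderiv_const_smul (hφ.differentiable x)]
    rfl

lemma finite_waveLength_le (N : ℝ) : {k : Fin 2 → ℤ | waveLength k ≤ N}.Finite := by
  refine (Set.finite_Icc (fun _ => -⌈N⌉) (fun _ => ⌈N⌉)).subset fun k hk => ?_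
  have hki : ∀ i, |(k i : ℝ)| ≤ N := by
    intro i
    refine le_trans ?_ hk
    refine Real.abs_le_sqrt ?_
    exact Finset.single_le_sum (f := fun i => (k i : ℝ) ^ 2) (fun _ _ => sq_nonneg _)
      (Finset.mem_univ i)
  have h2 : ∀ i, |k i| ≤ ⌈N⌉ := fun i => by
    have := (hki i).trans (Int.le_ceil N)
    exact_mod_cast this
  exact ⟨fun i => (abs_le.1 (h2 i)).1, fun i => (abs_le.1 (h2 i)).2⟩

lemma mem_span_of_ae_eq_smul {f : Plane → ℝ} {m : Plane → L2Field}
    (hm : ∀ c, m c =ᵐ[cellMeasure] fun x => f x • c) (c : Plane) :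
    m c ∈ Submodule.span ℝ (Set.range fun i : Fin 2 => m (EuclideanSpace.single i (1 : ℝ))) := by
  have : m c = ∑ i, c i • m (EuclideanSpace.single i (1 : ℝ)) := by
    refine Lp.ext ?_
    rw [Fin.sum_univ_two]
    filter_upwards [hm c, Lp.coeFn_add (c 0 • m (EuclideanSpace.single 0 (1 : ℝ)))
      (c 1 • m (EuclideanSpace.single 1 (1 : ℝ))),
      Lp.coeFn_smul (c 0) (m (EuclideanSpace.single 0 (1 : ℝ))),
      Lp.coeFn_smul (c 1) (m (EuclideanSpace.single 1 (1 : ℝ))),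
      hm (EuclideanSpace.single 0 (1 : ℝ)), hm (EuclideanSpace.single 1 (1 : ℝ))]
      with x h0 h1 h2 h3 h4 h5
    rw [h0, h1, Pi.add_apply, h2, h3, Pi.smul_apply, Pi.smul_apply, h4, h5]
    ext i
    fin_cases i <;> simp [mul_comm]
  rw [this]
  exact Submodule.sum_mem _ fun i _ => Submodule.smul_mem _ _ (Submodule.subset_span ⟨i, rfl⟩)

/-- Finitely many wavenumbers, each with two amplitudes for `cos` and two for `sin`, span the space.
It is therefore closed, and `lowProj N` takes values in genuine trigonometric fields. -/
lemma finiteDimensional_trig (N : ℝ) : FiniteDimensional ℝ (trig N) := by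
  let F : Set L2Field := ⋃ k ∈ {k : Fin 2 → ℤ | waveLength k ≤ N},
    (Set.range fun i : Fin 2 => cosMode k (EuclideanSpace.single i (1 : ℝ))) ∪
    (Set.range fun i : Fin 2 => sinMode k (EuclideanSpace.single i (1 : ℝ)))
  have hF : F.Finite := (finite_waveLength_le N).biUnion fun k _ =>
    (Set.finite_range _).union (Set.finite_range _)
  have hle : trig N ≤ Submodule.span ℝ F := by
    refine Submodule.span_le.2 fun w hw => ?_
    obtain ⟨k, c, hk, rfl | rfl⟩ := mem_lowModes_iff.1 hw
    · have hs : (Set.range fun i : Fin 2 => cosMode k (EuclideanSpace.single i (1 : ℝ))) ⊆ F :=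
        fun y hy => Set.mem_iUnion₂.2 ⟨k, hk, Or.inl hy⟩
      exact Submodule.span_mono hs (mem_span_of_ae_eq_smul (coeFn_cosMode k) c)
    · have hs : (Set.range fun i : Fin 2 => sinMode k (EuclideanSpace.single i (1 : ℝ))) ⊆ F :=
        fun y hy => Set.mem_iUnion₂.2 ⟨k, hk, Or.inr hy⟩
      exact Submodule.span_mono hs (mem_span_of_ae_eq_smul (coeFn_sinMode k) c)
  have : FiniteDimensional ℝ (Submodule.span ℝ F) := FiniteDimensional.span_of_finite ℝ hF
  exact Submodule.finiteDimensional_of_le hle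

lemma topologicalClosure_trig (N : ℝ) : (trig N).topologicalClosure = trig N := by
  have := finiteDimensional_trig N
  exact (Submodule.closed_of_finiteDimensional (trig N)).submodule_topologicalClosure_eq

/-! ### Completeness of the Fourier modes -/

/-- The projection of the plane onto the torus with periods `2π`. -/
noncomputable def toTorus (x : Plane) : UnitAddTorus (Fin 2) :=
  fun i => ((x i / (2 * Real.pi) : ℝ) : UnitAddCircle)

/-- The section of `toTorus` with values in the period cell. -/
noncomputable def ofTorus (y : UnitAddTorus (Fin 2)) : Plane :=
  WithLp.toLp 2 fun i => 2 * Real.pi * (UnitAddTorus.measurableEquivPiIoc 0 y).1 i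

lemma measurable_toTorus : Measurable toTorus := by
  refine measurable_pi_lambda _ fun i => ?_
  exact (AddCircle.measurable_mk' (a := (1 : ℝ))).comp
    (by fun_prop : Measurable fun x : Plane => x i / (2 * Real.pi))

lemma measurable_ofTorus : Measurable ofTorus := by
  refine (WithLp.measurable_toLp 2 _).comp (measurable_pi_lambda _ fun i => ?_)
  exact ((measurable_pi_apply i).comp (measurable_subtype_coe.comp
    (UnitAddTorus.measurableEquivPiIoc (0 : Fin 2 → ℝ)).measurable)).const_mul _

lemma ofTorus_toTorus {x : Plane} (hx : x ∈ cell) : ofTorus (toTorus x) = x := by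
  have hpi : 0 < 2 * Real.pi := by positivity
  have hy : ∀ i, x i / (2 * Real.pi) ∈ Set.Ioc ((0 : Fin 2 → ℝ) i) ((0 : Fin 2 → ℝ) i + 1) := by
    intro i
    obtain ⟨h1, h2⟩ := hx i
    simp only [Pi.zero_apply, zero_add, Set.mem_Ioc]
    exact ⟨by positivity, (div_le_one hpi).2 h2⟩
  have h1 : toTorus x = (UnitAddTorus.measurableEquivPiIoc (0 : Fin 2 → ℝ)).symm
      ⟨fun i => x i / (2 * Real.pi), hy⟩ := by
    rw [UnitAddTorus.coe_symm_measurableEquivPiIoc_apply]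
    rfl
  ext i
  simp only [ofTorus]
  rw [h1, MeasurableEquiv.apply_symm_apply]
  simp only
  field_simp

lemma mFourier_toTorus (k : Fin 2 → ℤ) (x : Plane) :
    UnitAddTorus.mFourier k (toTorus x) =
      (Real.cos (phase k x) : ℂ) + Real.sin (phase k x) * Complex.I := by
  have h : ∀ i, fourier (k i) (toTorus x i) = Complex.exp ((k i * x i : ℝ) * Complex.I) := by
    intro i
    simp only [toTorus]
    rw [fourier_coe_apply]
    congr 1
    have : (Real.pi : ℂ) ≠ 0 := by exact_mod_cast Real.pi_ne_zero
    push_cast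
    field_simp
  simp only [UnitAddTorus.mFourier, ContinuousMap.coe_mk]
  rw [Fin.prod_univ_two, h, h, ← Complex.exp_add, ← add_mul, ← Complex.ofReal_add,
    Complex.exp_mul_I, phase_apply, Fin.sum_univ_two, Complex.ofReal_cos, Complex.ofReal_sin]

lemma inner_eq_integral_of_ae_eq_smul {e u : L2Field} {f : Plane → ℝ} {i : Fin 2}
    (he : e =ᵐ[cellMeasure] fun x => f x • EuclideanSpace.single i (1 : ℝ)) :
    ⟪e, u⟫ = ∫ x, f x * u x i ∂cellMeasure := by
  rw [L2.inner_def]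
  refine integral_congr_ae ?_
  filter_upwards [he] with x hx
  rw [hx, real_inner_smul_left]
  simp [EuclideanSpace.inner_single_left]

lemma integrable_mul_apply {f : Plane → ℝ} (hf : Continuous f) (u : L2Field) (i : Fin 2) :
    Integrable (fun x => f x * u x i) cellMeasure := by
  have := (coord i).integrable_comp (memLp_one_iff_integrable.1
    ((Lp.memLp u).smul (p := 2) (q := 2) (r := 1) (memLp_of_continuous hf 2)))
  refine this.congr (Eventually.of_forall fun x => ?_)
  simp [coord]

/-- Completeness of the Fourier modes, transported from the torus. A coordinate of `u` becomes a
function on `UnitAddTorus` orthogonal to every `mFourier k`, hence to all continuous functions by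
uniform density of the trigonometric polynomials, hence to itself by density of continuous functions
in `L²`. -/
lemma ae_apply_eq_zero_of_inner_modes {u : L2Field}
    (hc : ∀ k c, ⟪cosMode k c, u⟫ = 0) (hs : ∀ k c, ⟪sinMode k c, u⟫ = 0) (i : Fin 2) :
    ∀ᵐ x ∂cellMeasure, u x i = 0 := by
  -- Both density statements hold for the image of the cell measure as a mere finite measure, so it
  -- need not be identified with Haar measure.
  set ρ : Measure (UnitAddTorus (Fin 2)) := cellMeasure.map toTorus with hρ
  have hmeas : AEMeasurable toTorus cellMeasure := measurable_toTorus.aemeasurable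
  have : IsFiniteMeasure ρ := Measure.isFiniteMeasure_map _ _
  let G : UnitAddTorus (Fin 2) → ℂ := fun y => ((u (ofTorus y) i : ℝ) : ℂ)
  have hGm : Measurable G := by
    have h1 : Measurable (fun x => u x) := (Lp.stronglyMeasurable u).measurable
    have h2 : Measurable (fun x : Plane => ((x i : ℝ) : ℂ)) :=
      Complex.measurable_ofReal.comp (by fun_prop)
    exact h2.comp (h1.comp measurable_ofTorus)
  have hGae : (fun x => G (toTorus x)) =ᵐ[cellMeasure] fun x => ((u x i : ℝ) : ℂ) := by
    refine (ae_restrict_iff' measurableSet_cell).2 (Eventually.of_forall fun x hx => ?_)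
    simp only [G, ofTorus_toTorus hx]
  have hGL : MemLp G 2 ρ := by
    rw [hρ, memLp_map_measure_iff hGm.aestronglyMeasurable hmeas]
    refine MemLp.ae_eq hGae.symm ?_
    have h1 : MemLp (fun x => u x i) 2 cellMeasure := (coord i).comp_memLp' (Lp.memLp u)
    exact h1.ofReal
  let Gl : Lp ℂ 2 ρ := hGL.toLp G
  have hinner : ∀ F : C(UnitAddTorus (Fin 2), ℂ),
      inner ℂ (ContinuousMap.toLp (E := ℂ) 2 ρ ℂ F) Gl =
        ∫ x, (starRingEnd ℂ) (F (toTorus x)) * ((u x i : ℝ) : ℂ) ∂cellMeasure := by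
    intro F
    rw [L2.inner_def]
    have h1 : ∫ y, inner ℂ (ContinuousMap.toLp (E := ℂ) 2 ρ ℂ F y) (Gl y) ∂ρ =
        ∫ y, (starRingEnd ℂ) (F y) * G y ∂ρ := by
      refine integral_congr_ae ?_
      filter_upwards [ContinuousMap.coeFn_toLp (p := 2) (𝕜 := ℂ) ρ F, hGL.coeFn_toLp] with y h1 h2
      rw [h1, h2, RCLike.inner_apply, mul_comm]
    rw [h1, hρ, integral_map hmeas]
    · refine integral_congr_ae ?_
      filter_upwards [hGae] with x hx
      rw [hx]
    · exact ((Complex.continuous_conj.comp F.continuous).measurable.mul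
        hGm).aestronglyMeasurable
  have hmode : ∀ k, inner ℂ (ContinuousMap.toLp (E := ℂ) 2 ρ ℂ (UnitAddTorus.mFourier k)) Gl = 0 := by
    intro k
    rw [hinner]
    have e1 := inner_eq_integral_of_ae_eq_smul (u := u)
      (coeFn_cosMode k (EuclideanSpace.single i (1 : ℝ)))
    have e2 := inner_eq_integral_of_ae_eq_smul (u := u)
      (coeFn_sinMode k (EuclideanSpace.single i (1 : ℝ)))
    rw [hc] at e1
    rw [hs] at e2
    have i1 := integrable_mul_apply (isPeriodicSmooth_cos k).continuous u i
    have i2 := integrable_mul_apply (isPeriodicSmooth_sin k).continuous u i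
    have : ∀ x, (starRingEnd ℂ) (UnitAddTorus.mFourier k (toTorus x)) * ((u x i : ℝ) : ℂ) =
        ((Real.cos (phase k x) * u x i : ℝ) : ℂ) -
          ((Real.sin (phase k x) * u x i : ℝ) : ℂ) * Complex.I := by
      intro x
      rw [mFourier_toTorus]
      simp only [map_add, map_mul, Complex.conj_ofReal, Complex.conj_I]
      push_cast
      ring
    simp_rw [this]
    rw [integral_sub i1.ofReal (i2.ofReal.mul_const _), integral_mul_const,
      integral_complex_ofReal, integral_complex_ofReal, ← e1, ← e2]
    simp
  have hall : ∀ F : C(UnitAddTorus (Fin 2), ℂ),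
      inner ℂ (ContinuousMap.toLp (E := ℂ) 2 ρ ℂ F) Gl = 0 := by
    intro F
    have hF : F ∈ (Submodule.span ℂ
        (Set.range (UnitAddTorus.mFourier (d := Fin 2)))).topologicalClosure := by
      rw [UnitAddTorus.span_mFourier_closure_eq_top]; trivial
    have hclosed : IsClosed {F : C(UnitAddTorus (Fin 2), ℂ) |
        inner ℂ (ContinuousMap.toLp (E := ℂ) 2 ρ ℂ F) Gl = 0} :=
      isClosed_eq (by fun_prop) continuous_const
    refine closure_minimal (fun F hF => ?_) hclosed hF
    change inner ℂ (ContinuousMap.toLp (E := ℂ) 2 ρ ℂ F) Gl = 0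
    induction hF using Submodule.span_induction with
    | mem F hF => obtain ⟨k, rfl⟩ := hF; exact hmode k
    | zero => simp
    | add a b _ _ ha hb => rw [map_add, inner_add_left, ha, hb, add_zero]
    | smul r a _ ha => rw [map_smul, inner_smul_left, ha, mul_zero]
  have hG0 : Gl = 0 := by
    have hd : DenseRange (ContinuousMap.toLp (E := ℂ) 2 ρ ℂ) :=
      ContinuousMap.toLp_denseRange ℂ ρ ℂ (by norm_num)
    have : inner ℂ Gl Gl = 0 := by
      refine DenseRange.induction_on (p := fun a : Lp ℂ 2 ρ => inner ℂ a Gl = 0) hd Gl ?_ hall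
      exact isClosed_eq (by fun_prop) continuous_const
    exact inner_self_eq_zero.1 this
  have h1 : G =ᵐ[ρ] 0 := by
    refine hGL.coeFn_toLp.symm.trans ?_
    change (Gl : UnitAddTorus (Fin 2) → ℂ) =ᵐ[ρ] 0
    rw [hG0]
    exact Lp.coeFn_zero _ _ _
  have h2 := ae_of_ae_map hmeas h1
  filter_upwards [h2, hGae] with x hx hx'
  rw [hx'] at hx
  exact Complex.ofReal_eq_zero.1 hx

lemma eq_zero_of_inner_trig {u : L2Field} (h : ∀ N, ∀ e ∈ trig N, ⟪e, u⟫ = 0) : u = 0 := by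
  have h' := ae_apply_eq_zero_of_inner_modes (u := u)
    (fun k c => h _ _ (cosMode_mem_trig (le_refl (waveLength k)) c))
    (fun k c => h _ _ (sinMode_mem_trig (le_refl (waveLength k)) c))
  refine Lp.ext ?_
  filter_upwards [h' 0, h' 1, Lp.coeFn_zero Plane 2 cellMeasure] with x h0 h1 hz
  rw [hz]
  ext i
  fin_cases i
  · exact h0
  · exact h1

/-! ### The Fourier projections and weak derivatives -/

lemma lowProj_mem_trig (N : ℝ) (u : L2Field) : lowProj N u ∈ trig N := by
  have := Submodule.starProjection_apply_mem ((trig N).topologicalClosure) u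
  exact (topologicalClosure_trig N).le this

lemma inner_sub_lowProj {N : ℝ} {e : L2Field} (he : e ∈ trig N) (u : L2Field) :
    ⟪u - lowProj N u, e⟫ = 0 :=
  Submodule.starProjection_inner_eq_zero (K := (trig N).topologicalClosure) u e
    ((trig N).le_topologicalClosure he)

lemma inner_lowProj {N : ℝ} {e : L2Field} (he : e ∈ trig N) (u : L2Field) :
    ⟪lowProj N u, e⟫ = ⟪u, e⟫ := by
  have := inner_sub_lowProj he u
  rw [inner_sub_left] at this
  linarith

lemma eq_lowProj {N : ℝ} {u v : L2Field} (hv : v ∈ trig N)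
    (h : ∀ e ∈ trig N, ⟪u - v, e⟫ = 0) : v = lowProj N u := by
  refine (Submodule.eq_starProjection_of_mem_of_inner_eq_zero
    (K := (trig N).topologicalClosure) ((trig N).le_topologicalClosure hv) ?_).symm
  rwa [topologicalClosure_trig]

lemma inner_lowProj_self (N : ℝ) (u : L2Field) : ⟪lowProj N u, u⟫ = ‖lowProj N u‖ ^ 2 := by
  rw [← real_inner_self_eq_norm_sq, real_inner_comm, ← inner_lowProj (lowProj_mem_trig N u) u]

lemma norm_lowProj_le (N : ℝ) (u : L2Field) : ‖lowProj N u‖ ≤ ‖u‖ :=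
  Submodule.norm_starProjection_apply_le _ u

/-- The Fourier projection onto the wavenumbers with `|k|² ≤ K`. -/
noncomputable abbrev sqProj (K : ℕ) : L2Field →L[ℝ] L2Field := lowProj (Real.sqrt K)

/-- The spaces `trig √K` increase, and by completeness of the modes their union has trivial
orthogonal complement. -/
lemma tendsto_sqProj (u : L2Field) :
    Tendsto (fun K : ℕ => sqProj K u) atTop (𝓝 u) := by
  have hmono : Monotone fun K : ℕ => (trig (Real.sqrt K)).topologicalClosure := by
    intro K L h
    change (trig _).topologicalClosure ≤ (trig _).topologicalClosure
    exact Submodule.topologicalClosure_mono (trig_mono (Real.sqrt_le_sqrt (by exact_mod_cast h)))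
  refine Submodule.starProjection_tendsto_self
    (fun K : ℕ => (trig (Real.sqrt K)).topologicalClosure) hmono u ?_
  rw [top_le_iff, Submodule.topologicalClosure_eq_top_iff, Submodule.eq_bot_iff]
  intro w hw
  refine eq_zero_of_inner_trig fun N e he => ?_
  refine (Submodule.mem_orthogonal _ w).1 hw e ?_
  obtain ⟨K, hK⟩ := exists_nat_ge (N ^ 2)
  refine Submodule.mem_iSup_of_mem K (Submodule.le_topologicalClosure _ (trig_mono ?_ he))
  exact Real.le_sqrt_of_sq_le hK

lemma exists_isWeakPartial_of_mem_trig {N : ℝ} {e : L2Field} (he : e ∈ trig N) (j : Fin 2) :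
    ∃ e' ∈ trig N, IsWeakPartial j e e' ∧
      ∀ u g, IsWeakPartial j u g → ⟪e', u⟫ = -⟪e, g⟫ := by
  obtain ⟨φ, hφ, heφ, h⟩ := exists_smooth_of_mem_trig he
  obtain ⟨e', he', hj⟩ := h j
  exact ⟨e', he', isWeakPartial_of_ae_eq hφ heφ hj, fun u g hu => hu.inner_eq hφ heφ hj⟩

/-- The pairings `⟪e, g⟫ = -⟪∂_j e, u⟫` with trigonometric fields determine `g`, by completeness. -/
lemma IsWeakPartial.unique {j : Fin 2} {u g h : L2Field} (hg : IsWeakPartial j u g)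
    (hh : IsWeakPartial j u h) : g = h := by
  rw [← sub_eq_zero]
  refine eq_zero_of_inner_trig fun N e he => ?_
  obtain ⟨e', -, -, h'⟩ := exists_isWeakPartial_of_mem_trig he j
  have h1 := h' u g hg
  have h2 := h' u h hh
  rw [inner_sub_right]
  linarith

lemma IsWeakPartial.inner_trig {N : ℝ} {j : Fin 2} {u g e e' : L2Field} (h : IsWeakPartial j u g)
    (he : e ∈ trig N) (he' : IsWeakPartial j e e') : ⟪e', u⟫ = -⟪e, g⟫ := by
  obtain ⟨e'', -, h1, h2⟩ := exists_isWeakPartial_of_mem_trig he j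
  rw [he'.unique h1]
  exact h2 u g h

lemma IsWeakPartial.weakPartial_eq {j : Fin 2} {u g : L2Field} (h : IsWeakPartial j u g) :
    weakPartial j u = g := by
  have hex : ∃ g, IsWeakPartial j u g := ⟨g, h⟩
  rw [weakPartial, dif_pos hex]
  exact hex.choose_spec.unique h

lemma isWeakPartial_weakPartial {j : Fin 2} {u : L2Field} (h : ∃ g, IsWeakPartial j u g) :
    IsWeakPartial j u (weakPartial j u) := by
  obtain ⟨g, hg⟩ := h
  rwa [hg.weakPartial_eq]

/-- `∂_j` preserves `trig N` and is skew-adjoint against it, so it commutes with the orthogonal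
projection onto that space. -/
lemma IsWeakPartial.map_lowProj {j : Fin 2} {u g : L2Field} (h : IsWeakPartial j u g) (N : ℝ) :
    IsWeakPartial j (lowProj N u) (lowProj N g) := by
  obtain ⟨e', he', hw, -⟩ := exists_isWeakPartial_of_mem_trig (lowProj_mem_trig N u) j
  suffices e' = lowProj N g from this ▸ hw
  refine eq_lowProj he' fun a ha => ?_
  obtain ⟨a', ha', hw', -⟩ := exists_isWeakPartial_of_mem_trig ha j
  have h1 := hw.inner_trig ha hw'
  have h2 := h.inner_trig ha hw'
  rw [real_inner_comm, inner_lowProj ha'] at h1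
  rw [real_inner_comm] at h2
  rw [inner_sub_left, real_inner_comm, real_inner_comm a e']
  linarith

/-- After truncating `u`, the left factor is a trigonometric field and the rule is the one for test
fields; then the cut-off tends to infinity. -/
lemma IsWeakPartial.inner_eq_neg_inner {j : Fin 2} {u g v h : L2Field} (hu : IsWeakPartial j u g)
    (hv : IsWeakPartial j v h) : ⟪g, v⟫ = -⟪u, h⟫ := by
  have h1 : ∀ K : ℕ, ⟪sqProj K g, v⟫ = -⟪sqProj K u, h⟫ := fun K =>
    hv.inner_trig (lowProj_mem_trig _ u) (hu.map_lowProj _)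
  have t1 : Tendsto (fun K : ℕ => ⟪sqProj K g, v⟫) atTop (𝓝 ⟪g, v⟫) :=
    (tendsto_sqProj g).inner tendsto_const_nhds
  have t2 : Tendsto (fun K : ℕ => -⟪sqProj K u, h⟫) atTop (𝓝 (-⟪u, h⟫)) :=
    ((tendsto_sqProj u).inner tendsto_const_nhds).neg
  exact tendsto_nhds_unique t1 (t2.congr fun K => (h1 K).symm)

/-! ### The spectral gap -/

/-- A Fourier mode of wavenumber `k` is an eigenfunction of the Laplacian, with eigenvalue
`-|k|²`. -/
lemma exists_laplacian_of_mem_lowModes {N : ℝ} {e : L2Field} (he : e ∈ lowModes N) :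
    ∃ (k : Fin 2 → ℤ) (d : Fin 2 → L2Field) (dd : Fin 2 → L2Field), waveLength k ≤ N ∧
      e ∈ lowModes (waveLength k) ∧
      (∀ j, IsWeakPartial j e (d j)) ∧ (∀ j, IsWeakPartial j (d j) (dd j)) ∧
      (∀ j, d j ∈ trig N) ∧ ∑ j, dd j = -(waveLength k ^ 2) • e := by
  have hsq : ∀ k, waveLength k ^ 2 = ∑ i, (k i : ℝ) ^ 2 := fun k =>
    Real.sq_sqrt (Finset.sum_nonneg fun _ _ => sq_nonneg _)
  obtain ⟨k, c, hk, rfl | rfl⟩ := mem_lowModes_iff.1 he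
  · refine ⟨k, fun j => -(k j : ℝ) • sinMode k c,
      fun j => -(k j : ℝ) • (k j : ℝ) • cosMode k c, hk,
      mem_lowModes_iff.2 ⟨k, c, le_rfl, Or.inl rfl⟩, isWeakPartial_cosMode k c,
      fun j => (isWeakPartial_sinMode k c j).smul _,
      fun j => Submodule.smul_mem _ _ (sinMode_mem_trig hk c), ?_⟩
    rw [hsq, Fin.sum_univ_two, Fin.sum_univ_two]
    module
  · refine ⟨k, fun j => (k j : ℝ) • cosMode k c,
      fun j => (k j : ℝ) • -(k j : ℝ) • sinMode k c, hk,
      mem_lowModes_iff.2 ⟨k, c, le_rfl, Or.inr rfl⟩, isWeakPartial_sinMode k c,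
      fun j => (isWeakPartial_cosMode k c j).smul _,
      fun j => Submodule.smul_mem _ _ (cosMode_mem_trig hk c), ?_⟩
    rw [hsq, Fin.sum_univ_two, Fin.sum_univ_two]
    module

lemma waveLength_sq (k : Fin 2 → ℤ) : ∃ m : ℕ, waveLength k ^ 2 = m := by
  refine ⟨(∑ i, k i ^ 2).toNat, ?_⟩
  have h : (0 : ℤ) ≤ ∑ i, k i ^ 2 := Finset.sum_nonneg fun _ _ => sq_nonneg _
  rw [waveLength, Real.sq_sqrt (Finset.sum_nonneg fun _ _ => sq_nonneg _)]
  have : (((∑ i, k i ^ 2).toNat : ℤ) : ℝ) = ((∑ i, k i ^ 2 : ℤ) : ℝ) := by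
    rw [Int.toNat_of_nonneg h]
  push_cast at this
  exact this.symm

/-- If `p` has only wavenumbers with `|k|² = K + 1`, then `-Δ p = (K + 1) p` weakly. -/
lemma sum_inner_weakPartial_of_shell {K : ℕ} {p q : L2Field} {dp dq : Fin 2 → L2Field}
    (hpK : ∀ e ∈ trig (Real.sqrt K), ⟪p, e⟫ = 0)
    (hq : q ∈ trig (Real.sqrt (K + 1 : ℕ)))
    (hdp : ∀ j, IsWeakPartial j p (dp j)) (hdq : ∀ j, IsWeakPartial j q (dq j)) :
    ∑ j, ⟪dp j, dq j⟫ = (K + 1 : ℕ) * ⟪p, q⟫ := by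
  induction hq using Submodule.span_induction generalizing dq with
  | mem e he =>
    obtain ⟨k, d, dd, hk, hek, hd, hdd, hdm, hsum⟩ := exists_laplacian_of_mem_lowModes he
    have h1 : ∀ j, ⟪dp j, dq j⟫ = -⟪p, dd j⟫ := fun j => by
      rw [(hdq j).unique (hd j)]
      exact (hdp j).inner_eq_neg_inner (hdd j)
    simp_rw [h1]
    rw [Finset.sum_neg_distrib, ← inner_sum, hsum, inner_smul_right]
    -- A mode with `|k|² ≤ K` is orthogonal to `p`. Otherwise `K < |k|² ≤ K + 1`, and since `|k|²`
    -- is an integer it equals `K + 1`.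
    by_cases hkK : waveLength k ≤ Real.sqrt K
    · rw [hpK e (Submodule.subset_span ?_)]
      · simp
      · obtain ⟨k', c, hk', h⟩ := mem_lowModes_iff.1 hek
        exact mem_lowModes_iff.2 ⟨k', c, hk'.trans hkK, h⟩
    · obtain ⟨m, hm⟩ := waveLength_sq k
      have hk0 : 0 ≤ waveLength k := Real.sqrt_nonneg _
      have h2 : m ≤ K + 1 := by
        have := (Real.le_sqrt' (by
          rcases hk0.eq_or_lt with h | h
          · exact absurd (h ▸ Real.sqrt_nonneg _) hkK
          · exact h)).1 hk
        rw [hm] at this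
        exact_mod_cast this
      have h3 : K < m := by
        by_contra hcon
        refine hkK (Real.le_sqrt_of_sq_le ?_)
        rw [hm]
        exact_mod_cast not_lt.1 hcon
      have : m = K + 1 := by omega
      rw [hm, this]
      ring
  | zero =>
    have : ∀ j, dq j = 0 := fun j => (hdq j).unique (isWeakPartial_zero j)
    simp [this]
  | add a b ha hb iha ihb =>
    have h1 := fun j => exists_isWeakPartial_of_mem_trig (N := Real.sqrt (K + 1 : ℕ)) ha j
    have h2 := fun j => exists_isWeakPartial_of_mem_trig (N := Real.sqrt (K + 1 : ℕ)) hb j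
    choose da _ hda _ using h1
    choose db _ hdb _ using h2
    have : ∀ j, dq j = da j + db j := fun j => (hdq j).unique ((hda j).add (hdb j))
    simp_rw [this, inner_add_right]
    rw [Finset.sum_add_distrib, iha hda, ihb hdb]
    ring
  | smul r a ha iha =>
    have h1 := fun j => exists_isWeakPartial_of_mem_trig (N := Real.sqrt (K + 1 : ℕ)) ha j
    choose da _ hda _ using h1
    have : ∀ j, dq j = r • da j := fun j => (hdq j).unique ((hda j).smul r)
    simp_rw [this, inner_smul_right]
    rw [← Finset.mul_sum, iha hda]
    ring

lemma lowProj_eq_sqProj_floor {N : ℝ} (hN : 0 ≤ N) : lowProj N = sqProj ⌊N ^ 2⌋₊ := by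
  have : lowModes N = lowModes (Real.sqrt (⌊N ^ 2⌋₊ : ℕ)) := by
    ext w
    rw [mem_lowModes_iff, mem_lowModes_iff]
    refine exists_congr fun k => exists_congr fun c => and_congr_left fun _ => ?_
    obtain ⟨m, hm⟩ := waveLength_sq k
    have hk0 : 0 ≤ waveLength k := Real.sqrt_nonneg _
    rw [Real.le_sqrt hk0 (by positivity), hm, Nat.cast_le, Nat.le_floor_iff (by positivity), ← hm]
    exact (sq_le_sq₀ hk0 hN).symm
  have ht : trig N = trig (Real.sqrt (⌊N ^ 2⌋₊ : ℕ)) := by rw [trig, this, trig]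
  exact ContinuousLinearMap.ext fun u => eq_lowProj (ht ▸ lowProj_mem_trig N u)
    fun e he => inner_sub_lowProj (ht ▸ he) u

/-- The spectral gap inequality `N² |u - P_N u|² ≤ |∇u|²`. -/
lemma sq_mul_norm_sub_lowProj_le {N : ℝ} (hN : 0 ≤ N) {u : L2Field} {g : Fin 2 → L2Field}
    (h : ∀ j, IsWeakPartial j u (g j)) :
    N ^ 2 * (‖u‖ ^ 2 - ‖lowProj N u‖ ^ 2) ≤ ∑ j, ‖g j‖ ^ 2 := by
  rw [lowProj_eq_sqProj_floor hN]
  set K₀ := ⌊N ^ 2⌋₊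
  -- Adding the shell `|k|² = K + 1` increases `a` by `(K + 1 - N²)|p|²`, where `p` is the part of
  -- `u` on that shell; this is nonnegative for `K ≥ ⌊N²⌋`. So `a K₀`, which is at least `-N²|P_N
  -- u|²`, is at most the limit `|∇u|² - N²|u|²`.
  let a : ℕ → ℝ := fun K => ∑ j, ‖sqProj K (g j)‖ ^ 2 - N ^ 2 * ‖sqProj K u‖ ^ 2
  have hstep : ∀ K, K₀ ≤ K → a K ≤ a (K + 1) := by
    intro K hK
    have hle : Real.sqrt K ≤ Real.sqrt (K + 1 : ℕ) := Real.sqrt_le_sqrt (by norm_num)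
    set p := sqProj (K + 1) u - sqProj K u with hp
    have hpm : p ∈ trig (Real.sqrt (K + 1 : ℕ)) :=
      sub_mem (lowProj_mem_trig _ _) (trig_mono hle (lowProj_mem_trig _ _))
    have horth : ∀ (w : L2Field) e, e ∈ trig (Real.sqrt K) →
        ⟪sqProj (K + 1) w - sqProj K w, e⟫ = 0 := by
      intro w e he
      rw [inner_sub_left, inner_lowProj he, inner_lowProj (trig_mono hle he), sub_self]
    have hdp : ∀ j, IsWeakPartial j p (sqProj (K + 1) (g j) - sqProj K (g j)) := fun j =>
      ((h j).map_lowProj _).sub ((h j).map_lowProj _)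
    have hgap := sum_inner_weakPartial_of_shell (horth u) hpm hdp hdp
    have hpyth : ∀ w : L2Field, ‖sqProj (K + 1) w‖ ^ 2 =
        ‖sqProj K w‖ ^ 2 + ‖sqProj (K + 1) w - sqProj K w‖ ^ 2 := by
      intro w
      have h1 := horth w _ (lowProj_mem_trig _ w)
      have h2 := norm_add_sq_real (sqProj (K + 1) w - sqProj K w) (sqProj K w)
      rw [h1, sub_add_cancel] at h2
      linarith
    rw [Fin.sum_univ_two, real_inner_self_eq_norm_sq, real_inner_self_eq_norm_sq,
      real_inner_self_eq_norm_sq] at hgap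
    have hN2 : N ^ 2 ≤ (K + 1 : ℕ) := by
      have h1 : N ^ 2 < K₀ + 1 := Nat.lt_floor_add_one _
      have h2 : (K₀ : ℝ) ≤ K := by exact_mod_cast hK
      push_cast
      linarith
    have : N ^ 2 * ‖p‖ ^ 2 ≤ (K + 1 : ℕ) * ‖p‖ ^ 2 :=
      mul_le_mul_of_nonneg_right hN2 (sq_nonneg _)
    simp only [a]
    rw [Fin.sum_univ_two, Fin.sum_univ_two, hpyth (g 0), hpyth (g 1), hpyth u]
    linarith
  have hmono : ∀ K, K₀ ≤ K → a K₀ ≤ a K := by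
    intro K hK
    induction K, hK using Nat.le_induction with
    | base => exact le_rfl
    | succ K hK ih => exact ih.trans (hstep K hK)
  have hlim : Tendsto a atTop (𝓝 (∑ j, ‖g j‖ ^ 2 - N ^ 2 * ‖u‖ ^ 2)) :=
    (tendsto_finsetSum _ fun j _ => ((tendsto_sqProj (g j)).norm.pow 2)).sub
      (((tendsto_sqProj u).norm.pow 2).const_mul _)
  have hfin : a K₀ ≤ ∑ j, ‖g j‖ ^ 2 - N ^ 2 * ‖u‖ ^ 2 :=
    ge_of_tendsto hlim (eventually_atTop.2 ⟨K₀, hmono⟩)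
  have h0 : 0 ≤ ∑ j, ‖sqProj K₀ (g j)‖ ^ 2 := Finset.sum_nonneg fun _ _ => sq_nonneg _
  simp only [a] at hfin
  linarith

/-! ### Ladyzhenskaya's inequality -/

/-- For every `y` the value `s x` exceeds `s y` by at most the total variation; averaging over `y`
gives the bound. -/
lemma le_average_add_integral_abs_deriv {s s' : ℝ → ℝ} {T x : ℝ} (hT : 0 < T)
    (hs : ∀ y, HasDerivAt s (s' y) y) (hs' : Continuous s') (hx : x ∈ Set.Icc 0 T) :
    s x ≤ ∫ y in (0 : ℝ)..T, (T⁻¹ * s y + |s' y|) := by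
  have hsc : Continuous s := continuous_iff_continuousAt.2 fun y => (hs y).continuousAt
  set D := ∫ y in (0 : ℝ)..T, |s' y| with hD
  have h1 : ∀ y ∈ Set.Icc 0 T, s x - D ≤ s y := by
    intro y hy
    have e : ∫ z in y..x, s' z = s x - s y :=
      intervalIntegral.integral_eq_sub_of_hasDerivAt (fun z _ => hs z) (hs'.intervalIntegrable _ _)
    have h2 : |∫ z in y..x, s' z| ≤ ∫ z in Set.uIoc y x, |s' z| :=
      by simpa only [Real.norm_eq_abs] using
        intervalIntegral.norm_integral_le_integral_norm_uIoc (f := s') (μ := volume)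
    have h3 : ∫ z in Set.uIoc y x, |s' z| ≤ D := by
      rw [hD, intervalIntegral.integral_of_le hT.le]
      refine setIntegral_mono_set (hs'.abs.integrableOn_Ioc) (Eventually.of_forall fun z => abs_nonneg _)
        (Eventually.of_forall fun z hz => ?_)
      exact ⟨lt_of_le_of_lt (le_min hy.1 hx.1) hz.1, hz.2.trans (max_le hy.2 hx.2)⟩
    have h4 := le_abs_self (∫ z in y..x, s' z)
    linarith
  have h5 : ∫ _ in (0 : ℝ)..T, (s x - D) ≤ ∫ y in (0 : ℝ)..T, s y :=
    intervalIntegral.integral_mono_on hT.le (by simp) (hsc.intervalIntegrable _ _) h1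
  rw [intervalIntegral.integral_const, sub_zero, smul_eq_mul] at h5
  rw [intervalIntegral.integral_add ((hsc.const_mul _).intervalIntegrable _ _)
    (hs'.abs.intervalIntegrable _ _), intervalIntegral.integral_const_mul, ← hD]
  have h6 : T⁻¹ * (T * (s x - D)) ≤ T⁻¹ * ∫ y in (0 : ℝ)..T, s y :=
    mul_le_mul_of_nonneg_left h5 (by positivity)
  rw [inv_mul_cancel_left₀ hT.ne'] at h6
  linarith

/-- The core of Ladyzhenskaya's argument. One factor of `F²` is bounded by a function of `b` alone
and the other by a function of `a` alone, so the double integral of the product splits. -/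
lemma integral_sq_le_mul_of_le_line_integrals {F p q : Plane → ℝ} (hF : Continuous F)
    (hF0 : ∀ x, 0 ≤ F x) (hp : Continuous p) (hq : Continuous q)
    (hFp : ∀ a ∈ Set.Icc 0 (2 * Real.pi), ∀ b,
      F (point (a, b)) ≤ ∫ t in (0 : ℝ)..2 * Real.pi, p (point (t, b)))
    (hFq : ∀ a, ∀ b ∈ Set.Icc 0 (2 * Real.pi),
      F (point (a, b)) ≤ ∫ t in (0 : ℝ)..2 * Real.pi, q (point (a, t))) :
    ∫ x, F x ^ 2 ∂cellMeasure ≤ (∫ x, p x ∂cellMeasure) * ∫ x, q x ∂cellMeasure := by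
  have hpi : (0 : ℝ) ≤ 2 * Real.pi := by positivity
  have hpt := continuous_point
  rw [setIntegral_cell (by fun_prop), setIntegral_cell_swap hp, setIntegral_cell hq]
  set P : ℝ → ℝ := fun b => ∫ t in (0 : ℝ)..2 * Real.pi, p (point (t, b)) with hP
  set Q : ℝ → ℝ := fun a => ∫ t in (0 : ℝ)..2 * Real.pi, q (point (a, t)) with hQ
  have hPc : Continuous P := intervalIntegral.continuous_parametric_intervalIntegral_of_continuous'
    (f := fun b t => p (point (t, b)))
    (hp.comp (hpt.comp (by fun_prop : Continuous fun z : ℝ × ℝ => (z.2, z.1)))) _ _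
  have hQc : Continuous Q := intervalIntegral.continuous_parametric_intervalIntegral_of_continuous'
    (f := fun a t => q (point (a, t))) (hq.comp hpt) _ _
  have hFc : ∀ a, Continuous fun b => F (point (a, b)) ^ 2 := fun a =>
    (hF.comp (hpt.comp (by fun_prop : Continuous fun b : ℝ => (a, b)))).pow 2
  have hFF : Continuous fun a => ∫ b in (0 : ℝ)..2 * Real.pi, F (point (a, b)) ^ 2 :=
    intervalIntegral.continuous_parametric_intervalIntegral_of_continuous'
      (f := fun a b => F (point (a, b)) ^ 2) (by unfold Function.uncurry; fun_prop) _ _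
  calc ∫ a in (0 : ℝ)..2 * Real.pi, ∫ b in (0 : ℝ)..2 * Real.pi, F (point (a, b)) ^ 2
      ≤ ∫ a in (0 : ℝ)..2 * Real.pi, Q a * ∫ b in (0 : ℝ)..2 * Real.pi, P b := by
        refine intervalIntegral.integral_mono_on hpi (hFF.intervalIntegrable _ _)
          ((hQc.mul_const _).intervalIntegrable _ _) fun a ha => ?_
        rw [← intervalIntegral.integral_const_mul]
        refine intervalIntegral.integral_mono_on hpi ((hFc a).intervalIntegrable _ _)
          ((hPc.const_mul _).intervalIntegrable _ _) fun b hb => ?_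
        rw [sq]
        exact mul_le_mul (hFq a b hb) (hFp a ha b) (hF0 _) ((hF0 _).trans (hFq a b hb))
    _ = (∫ b in (0 : ℝ)..2 * Real.pi, P b) * ∫ a in (0 : ℝ)..2 * Real.pi, Q a := by
        rw [intervalIntegral.integral_mul_const, mul_comm]

lemma pderiv_norm_sq {φ : Plane → Plane} (h : Differentiable ℝ φ) (j : Fin 2) (x : Plane) :
    pderiv j (fun x => ‖φ x‖ ^ 2) x = 2 * ⟪φ x, pderiv j φ x⟫ := by
  simp only [pderiv]
  rw [((h x).hasFDerivAt.norm_sq).fderiv]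
  simp

lemma IsPeriodicSmooth.norm_sq {φ : Plane → Plane} (h : IsPeriodicSmooth φ) :
    IsPeriodicSmooth fun x => ‖φ x‖ ^ 2 :=
  ⟨h.contDiff.norm_sq ℝ, fun i x => by simp only [h.periodic]⟩

lemma norm_sq_eq_integral (u : L2Field) : ‖u‖ ^ 2 = ∫ x, ‖u x‖ ^ 2 ∂cellMeasure := by
  rw [← real_inner_self_eq_norm_sq, L2.inner_def]
  simp_rw [real_inner_self_eq_norm_sq]

lemma memLp_norm (u : L2Field) : MemLp (fun x => ‖u x‖) 2 cellMeasure := (Lp.memLp u).norm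

lemma integral_norm_mul_norm_le (u v : L2Field) :
    ∫ x, ‖u x‖ * ‖v x‖ ∂cellMeasure ≤ ‖u‖ * ‖v‖ := by
  have h := integral_mul_le_Lp_mul_Lq_of_nonneg (μ := cellMeasure) Real.HolderConjugate.two_two
    (f := fun x => ‖u x‖) (g := fun x => ‖v x‖) (Eventually.of_forall fun x => norm_nonneg _)
    (Eventually.of_forall fun x => norm_nonneg _) (by simpa using memLp_norm u)
    (by simpa using memLp_norm v)
  refine h.trans (le_of_eq ?_)
  simp only [Real.rpow_two]
  rw [← norm_sq_eq_integral, ← norm_sq_eq_integral, ← Real.sqrt_eq_rpow, ← Real.sqrt_eq_rpow,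
    Real.sqrt_sq (norm_nonneg _), Real.sqrt_sq (norm_nonneg _)]

/-- The line-integral bound is applied to `F = |φ|²`, with `∂_j |φ|² = 2 φ · ∂_j φ`; Cauchy–Schwarz
then estimates the integrals of the majorants. The factor `(2π)⁻¹` of the average is replaced by
`1`. -/
lemma integral_pow_four_le_of_smooth {φ : Plane → Plane} (hφ : IsPeriodicSmooth φ)
    {e : L2Field} {d : Fin 2 → L2Field} (he : e =ᵐ[cellMeasure] φ)
    (hd : ∀ j, d j =ᵐ[cellMeasure] pderiv j φ) {G : ℝ} (hG : ∀ j, ‖d j‖ ≤ G) :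
    ∫ x, ‖φ x‖ ^ 4 ∂cellMeasure ≤ (‖e‖ * (‖e‖ + 2 * G)) ^ 2 := by
  have hpi : (0 : ℝ) < 2 * Real.pi := by positivity
  have hs := hφ.norm_sq
  let p : Fin 2 → Plane → ℝ := fun j x =>
    (2 * Real.pi)⁻¹ * ‖φ x‖ ^ 2 + |pderiv j (fun x => ‖φ x‖ ^ 2) x|
  have hpc : ∀ j, Continuous (p j) := fun j =>
    (hs.continuous.const_mul _).add (hs.pderiv j).continuous.abs
  have hint : ∀ j, ∫ x, p j x ∂cellMeasure ≤ ‖e‖ * (‖e‖ + 2 * G) := by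
    intro j
    have hi : Integrable (fun x => ‖e x‖ * ‖d j x‖) cellMeasure :=
      memLp_one_iff_integrable.1 ((memLp_norm (d j)).mul' (p := 2) (q := 2) (r := 1) (memLp_norm e))
    have hi2 : Integrable (fun x => ‖e x‖ ^ 2) cellMeasure := (memLp_norm e).integrable_sq
    calc ∫ x, p j x ∂cellMeasure
        ≤ ∫ x, (‖e x‖ ^ 2 + 2 * (‖e x‖ * ‖d j x‖)) ∂cellMeasure := by
          refine integral_mono_ae (integrable_of_continuous (hpc j)) (hi2.add (hi.const_mul 2)) ?_
          filter_upwards [he, hd j] with x h1 h2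
          rw [h1, h2]
          simp only [p]
          rw [pderiv_norm_sq hφ.differentiable]
          have h3 := abs_real_inner_le_norm (φ x) (pderiv j φ x)
          have h4 : (2 * Real.pi)⁻¹ ≤ 1 := inv_le_one_of_one_le₀ (by linarith [Real.pi_gt_three])
          have h5 := mul_le_mul_of_nonneg_right h4 (sq_nonneg ‖φ x‖)
          rw [abs_mul, abs_two]
          linarith
      _ = ‖e‖ ^ 2 + 2 * ∫ x, ‖e x‖ * ‖d j x‖ ∂cellMeasure := by
          rw [integral_add hi2 (hi.const_mul 2), integral_const_mul, norm_sq_eq_integral]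
      _ ≤ ‖e‖ * (‖e‖ + 2 * G) := by
          have h1 := integral_norm_mul_norm_le e (d j)
          have h2 := mul_le_mul_of_nonneg_left (hG j) (norm_nonneg e)
          nlinarith
  have hnn : ∀ j, 0 ≤ ∫ x, p j x ∂cellMeasure := fun j =>
    integral_nonneg fun x => by positivity
  have key := integral_sq_le_mul_of_le_line_integrals (F := fun x => ‖φ x‖ ^ 2) hs.continuous
    (fun x => sq_nonneg _) (hpc 0) (hpc 1)
    (fun a ha b => le_average_add_integral_abs_deriv hpi
      (fun t => hasDerivAt_point_fst hs.differentiable t b)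
      ((hs.pderiv 0).continuous.comp
        (continuous_point.comp (by fun_prop : Continuous fun t : ℝ => (t, b)))) ha)
    (fun a b hb => le_average_add_integral_abs_deriv hpi
      (fun t => hasDerivAt_point_snd hs.differentiable a t)
      ((hs.pderiv 1).continuous.comp
        (continuous_point.comp (by fun_prop : Continuous fun t : ℝ => (a, t)))) hb)
  have h4 : ∀ x, ‖φ x‖ ^ 4 = (‖φ x‖ ^ 2) ^ 2 := fun x => by ring
  simp_rw [h4]
  refine key.trans ?_
  rw [sq]
  exact mul_le_mul (hint 0) (hint 1) (hnn 1) ((hnn 0).trans (hint 0))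

lemma eLpNorm_four_le_of_smooth {φ : Plane → Plane} (hφ : IsPeriodicSmooth φ)
    {e : L2Field} {d : Fin 2 → L2Field} (he : e =ᵐ[cellMeasure] φ)
    (hd : ∀ j, d j =ᵐ[cellMeasure] pderiv j φ) {G : ℝ} (hG : ∀ j, ‖d j‖ ≤ G) :
    eLpNorm e 4 cellMeasure ≤ ENNReal.ofReal (Real.sqrt (‖e‖ * (‖e‖ + 2 * G))) := by
  have h := integral_pow_four_le_of_smooth hφ he hd hG
  have hG0 : 0 ≤ G := (norm_nonneg _).trans (hG 0)
  rw [eLpNorm_congr_ae he, (memLp_of_continuous hφ.continuous 4).eLpNorm_eq_integral_rpow_norm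
    (by norm_num) (by norm_num)]
  refine ENNReal.ofReal_le_ofReal ?_
  have h4 : ENNReal.toReal 4 = 4 := by norm_num
  rw [h4]
  have h5 : ∀ x, ‖φ x‖ ^ (4 : ℝ) = ‖φ x‖ ^ 4 := fun x => by
    rw [← Real.rpow_natCast]; norm_num
  simp_rw [h5]
  set B := ‖e‖ * (‖e‖ + 2 * G) with hB
  have hB0 : 0 ≤ B := by positivity
  have h6 : (∫ x, ‖φ x‖ ^ 4 ∂cellMeasure) ^ (4 : ℝ)⁻¹ ≤ (B ^ 2) ^ (4 : ℝ)⁻¹ :=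
    Real.rpow_le_rpow (integral_nonneg fun x => by positivity) h (by norm_num)
  refine h6.trans (le_of_eq ?_)
  rw [Real.sqrt_eq_rpow, ← Real.rpow_natCast, ← Real.rpow_mul hB0]
  norm_num

/-- Ladyzhenskaya's inequality for fields with weak derivatives in `L²`. -/
lemma eLpNorm_four_le {u : L2Field} {g : Fin 2 → L2Field} (h : ∀ j, IsWeakPartial j u (g j))
    {G : ℝ} (hG : ∀ j, ‖g j‖ ≤ G) :
    eLpNorm u 4 cellMeasure ≤ ENNReal.ofReal (Real.sqrt (‖u‖ * (‖u‖ + 2 * G))) := by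
  have hG0 : 0 ≤ G := (norm_nonneg _).trans (hG 0)
  have hK : ∀ K : ℕ, eLpNorm (sqProj K u) 4 cellMeasure ≤
      ENNReal.ofReal (Real.sqrt (‖u‖ * (‖u‖ + 2 * G))) := by
    intro K
    obtain ⟨φ, hφ, heφ, hd⟩ := exists_smooth_of_mem_trig (lowProj_mem_trig (Real.sqrt K) u)
    choose d _ hd using hd
    have hdg : ∀ j, d j = sqProj K (g j) := fun j =>
      (isWeakPartial_of_ae_eq hφ heφ (hd j)).unique ((h j).map_lowProj _)
    refine (eLpNorm_four_le_of_smooth hφ heφ hd (G := G) fun j => ?_).trans ?_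
    · rw [hdg]
      exact (norm_lowProj_le _ _).trans (hG j)
    · refine ENNReal.ofReal_le_ofReal (Real.sqrt_le_sqrt ?_)
      have h1 := norm_lowProj_le (Real.sqrt K) u
      have h0 := norm_nonneg (sqProj K u)
      gcongr
  -- The `L⁴` bound is uniform in the truncation. `L²` convergence gives an almost everywhere
  -- convergent subsequence, and Fatou's lemma carries the bound to `u`.
  have htend := tendstoInMeasure_of_tendsto_eLpNorm (p := 2) (μ := cellMeasure) (l := atTop)
    (f := fun K : ℕ => (sqProj K u : Plane → Plane)) (g := u) (by norm_num)
    (fun K => Lp.aestronglyMeasurable _) (Lp.aestronglyMeasurable _)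
    ((Lp.tendsto_Lp_iff_tendsto_eLpNorm' _ _).1 (tendsto_sqProj u))
  obtain ⟨ns, hns, hae⟩ := htend.exists_seq_tendsto_ae
  refine (Lp.eLpNorm_lim_le_liminf_eLpNorm
    (f := fun n => (sqProj (ns n) u : Plane → Plane)) (fun n => Lp.aestronglyMeasurable _)
    _ hae).trans ?_
  exact (liminf_le_of_frequently_le' (Frequently.of_forall fun n => hK (ns n)))

/-! ### The trilinear form -/

/-- The `L⁴` norm of a field on the cell. -/
noncomputable def normFour (u : L2Field) : ℝ := (eLpNorm u 4 cellMeasure).toReal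

instance : ENNReal.HolderTriple 4 4 2 :=
  ⟨by
    have : (4 : ENNReal) = 2 * 2 := by norm_num
    rw [this, ENNReal.mul_inv (by norm_num) (by norm_num), ← two_mul, ← mul_assoc,
      ENNReal.mul_inv_cancel (by norm_num) (by norm_num), one_mul]⟩

lemma normFour_nonneg (u : L2Field) : 0 ≤ normFour u := ENNReal.toReal_nonneg

lemma memLp_four {u : L2Field} {g : Fin 2 → L2Field} (h : ∀ j, IsWeakPartial j u (g j)) :
    MemLp u 4 cellMeasure :=
  ⟨Lp.aestronglyMeasurable u, (eLpNorm_four_le h (G := ‖g 0‖ + ‖g 1‖) fun j => by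
    fin_cases j <;> simp).trans_lt ENNReal.ofReal_lt_top⟩

lemma normFour_sq_le {u : L2Field} {g : Fin 2 → L2Field} (h : ∀ j, IsWeakPartial j u (g j))
    {G : ℝ} (hG : ∀ j, ‖g j‖ ≤ G) : normFour u ^ 2 ≤ ‖u‖ * (‖u‖ + 2 * G) := by
  have hG0 : 0 ≤ G := (norm_nonneg _).trans (hG 0)
  have h1 := ENNReal.toReal_le_of_le_ofReal (Real.sqrt_nonneg _) (eLpNorm_four_le h hG)
  have h2 := pow_le_pow_left₀ (normFour_nonneg u) h1 2
  rwa [Real.sq_sqrt (by positivity)] at h2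

lemma integrable_norm_mul_norm (u v : L2Field) :
    Integrable (fun x => ‖u x‖ * ‖v x‖) cellMeasure :=
  memLp_one_iff_integrable.1 ((memLp_norm v).mul' (p := 2) (q := 2) (r := 1) (memLp_norm u))

/-- Hölder's inequality with exponents `4, 4, 2`, packaged as an `L²` field with modulus `|v||w|`.
The trilinear form is then bounded by the `L²` Cauchy–Schwarz inequality. -/
lemma exists_prod_field {v w : L2Field} (hv : MemLp v 4 cellMeasure) (hw : MemLp w 4 cellMeasure) :
    ∃ q : L2Field, (∀ᵐ x ∂cellMeasure, ‖q x‖ = ‖v x‖ * ‖w x‖) ∧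
      ‖q‖ ≤ normFour v * normFour w := by
  have h : MemLp (fun x => ‖v x‖ • w x) 2 cellMeasure := hw.smul (p := 4) (q := 4) hv.norm
  refine ⟨h.toLp _, ?_, ?_⟩
  · filter_upwards [h.coeFn_toLp] with x hx
    rw [hx, norm_smul, norm_norm]
  · rw [Lp.norm_toLp]
    have h1 := eLpNorm_smul_le_mul_eLpNorm (p := 4) (q := 4) (r := 2) (μ := cellMeasure)
      hw.1 hv.norm.1
    rw [eLpNorm_norm] at h1
    have h2 := ENNReal.toReal_mono (ENNReal.mul_ne_top hv.2.ne hw.2.ne) h1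
    rwa [ENNReal.toReal_mul] at h2

/-- The transport field `∑_j v_j d_j`, which is `(v · ∇) u` when `d = ∇ u`. -/
noncomputable def transport (v : L2Field) (d : Fin 2 → L2Field) (x : Plane) : Plane :=
  ∑ j, v x j • d j x

/-- The trilinear form `∫ (∑_j v_j d_j) · w`. -/
noncomputable def trilinear (v : L2Field) (d : Fin 2 → L2Field) (w : L2Field) : ℝ :=
  ∫ x, ⟪transport v d x, w x⟫ ∂cellMeasure

lemma aestronglyMeasurable_transport (v : L2Field) (d : Fin 2 → L2Field) :
    AEStronglyMeasurable (transport v d) cellMeasure := by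
  unfold transport
  refine Finset.aestronglyMeasurable_fun_sum _ fun j _ => ?_
  exact ((coord j).continuous.comp_aestronglyMeasurable (Lp.aestronglyMeasurable v)).smul
    (Lp.aestronglyMeasurable (d j))

lemma norm_transport_le (v : L2Field) (d : Fin 2 → L2Field) (x : Plane) :
    ‖transport v d x‖ ≤ ∑ j, ‖v x‖ * ‖d j x‖ := by
  refine (norm_sum_le _ _).trans (Finset.sum_le_sum fun j _ => ?_)
  rw [norm_smul]
  exact mul_le_mul_of_nonneg_right (PiLp.norm_apply_le (v x) j) (norm_nonneg _)

lemma memLp_transport {v : L2Field} {d : Fin 2 → L2Field} (hv : MemLp v 4 cellMeasure)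
    (hd : ∀ j, MemLp (d j) 4 cellMeasure) : MemLp (transport v d) 2 cellMeasure := by
  unfold transport
  refine memLp_finsetSum _ fun j _ => ?_
  exact (hd j).smul (p := 4) (q := 4) ((coord j).comp_memLp' hv)

lemma abs_inner_transport_le (v : L2Field) (d : Fin 2 → L2Field) (w : L2Field) (x : Plane) :
    |⟪transport v d x, w x⟫| ≤ ∑ j, ‖d j x‖ * (‖v x‖ * ‖w x‖) := by
  refine (abs_real_inner_le_norm _ _).trans ?_
  refine (mul_le_mul_of_nonneg_right (norm_transport_le v d x) (norm_nonneg _)).trans (le_of_eq ?_)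
  rw [Finset.sum_mul]
  exact Finset.sum_congr rfl fun j _ => by ring

lemma integrable_trilinear {v w : L2Field} (hv : MemLp v 4 cellMeasure)
    (hw : MemLp w 4 cellMeasure) (d : Fin 2 → L2Field) :
    Integrable (fun x => ⟪transport v d x, w x⟫) cellMeasure := by
  obtain ⟨q, hq, -⟩ := exists_prod_field hv hw
  have h : Integrable (fun x => ∑ j, ‖d j x‖ * ‖q x‖) cellMeasure :=
    integrable_finsetSum _ fun j _ => integrable_norm_mul_norm (d j) q
  refine h.mono' ((aestronglyMeasurable_transport v d).inner (Lp.aestronglyMeasurable w)) ?_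
  filter_upwards [hq] with x hx
  rw [hx]
  exact abs_inner_transport_le v d w x

lemma abs_trilinear_le {v w : L2Field} (hv : MemLp v 4 cellMeasure)
    (hw : MemLp w 4 cellMeasure) (d : Fin 2 → L2Field) :
    |trilinear v d w| ≤ (∑ j, ‖d j‖) * (normFour v * normFour w) := by
  obtain ⟨q, hq, hqn⟩ := exists_prod_field hv hw
  have h : Integrable (fun x => ∑ j, ‖d j x‖ * ‖q x‖) cellMeasure :=
    integrable_finsetSum _ fun j _ => integrable_norm_mul_norm (d j) q
  calc |trilinear v d w| ≤ ∫ x, ∑ j, ‖d j x‖ * ‖q x‖ ∂cellMeasure := by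
        rw [trilinear, ← Real.norm_eq_abs]
        refine norm_integral_le_of_norm_le h ?_
        filter_upwards [hq] with x hx
        rw [hx]
        exact abs_inner_transport_le v d w x
    _ = ∑ j, ∫ x, ‖d j x‖ * ‖q x‖ ∂cellMeasure :=
        integral_finsetSum _ fun j _ => integrable_norm_mul_norm (d j) q
    _ ≤ ∑ j, ‖d j‖ * ‖q‖ := Finset.sum_le_sum fun j _ => integral_norm_mul_norm_le (d j) q
    _ ≤ (∑ j, ‖d j‖) * (normFour v * normFour w) := by
        rw [← Finset.sum_mul]
        exact mul_le_mul_of_nonneg_left hqn (Finset.sum_nonneg fun _ _ => norm_nonneg _)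

lemma trilinear_sub_right {v w w' : L2Field} (hv : MemLp v 4 cellMeasure)
    (hw : MemLp w 4 cellMeasure) (hw' : MemLp w' 4 cellMeasure) (d : Fin 2 → L2Field) :
    trilinear v d (w - w') = trilinear v d w - trilinear v d w' := by
  unfold trilinear
  rw [← integral_sub (integrable_trilinear hv hw d) (integrable_trilinear hv hw' d)]
  refine integral_congr_ae ?_
  filter_upwards [Lp.coeFn_sub w w'] with x hx
  rw [hx, Pi.sub_apply, inner_sub_right]

lemma trilinear_sub_middle {v w : L2Field} (hv : MemLp v 4 cellMeasure)
    (hw : MemLp w 4 cellMeasure) (d d' : Fin 2 → L2Field) :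
    trilinear v (fun j => d j - d' j) w = trilinear v d w - trilinear v d' w := by
  unfold trilinear
  rw [← integral_sub (integrable_trilinear hv hw d) (integrable_trilinear hv hw d')]
  refine integral_congr_ae ?_
  filter_upwards [Lp.coeFn_sub (d 0) (d' 0), Lp.coeFn_sub (d 1) (d' 1)] with x h0 h1
  rw [← inner_sub_left]
  congr 1
  simp only [transport, Fin.sum_univ_two]
  rw [h0, h1, Pi.sub_apply, Pi.sub_apply]
  module

lemma trilinear_sub_left {v v' w : L2Field} (hv : MemLp v 4 cellMeasure)
    (hv' : MemLp v' 4 cellMeasure) (hw : MemLp w 4 cellMeasure) (d : Fin 2 → L2Field) :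
    trilinear (v - v') d w = trilinear v d w - trilinear v' d w := by
  unfold trilinear
  rw [← integral_sub (integrable_trilinear hv hw d) (integrable_trilinear hv' hw d)]
  refine integral_congr_ae ?_
  filter_upwards [Lp.coeFn_sub v v'] with x h0
  rw [← inner_sub_left]
  congr 1
  simp only [transport, Fin.sum_univ_two]
  rw [h0, Pi.sub_apply, PiLp.sub_apply, PiLp.sub_apply]
  module

/-! ### Solenoidal fields -/

lemma inner_eq_zero_of_mem_H {v w : L2Field} (hv : v ∈ H) (hw : w ∈ constantsAndGradients) :
    ⟪w, v⟫ = 0 :=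
  (Submodule.mem_orthogonal _ v).1 hv w (Submodule.subset_span hw)

lemma inner_gradient (ψ : Plane → ℝ) (x a : Plane) :
    ⟪gradient ψ x, a⟫ = ∑ j, a j * pderiv j ψ x := by
  rw [gradient, InnerProductSpace.toDual_symm_apply]
  have : a = ∑ j, a j • EuclideanSpace.single j (1 : ℝ) := by
    ext i; fin_cases i <;> simp
  conv_lhs => rw [this]
  rw [map_sum]
  refine Finset.sum_congr rfl fun j _ => ?_
  rw [map_smul, smul_eq_mul]; rfl

/-- The integrand is `½ v · ∇|φ|²`, and elements of `H` are orthogonal to gradients of test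
functions. -/
lemma trilinear_self_eq_zero_of_smooth {v e : L2Field} (hv : v ∈ H) {φ : Plane → Plane}
    (hφ : IsPeriodicSmooth φ) {d : Fin 2 → L2Field} (he : e =ᵐ[cellMeasure] φ)
    (hd : ∀ j, d j =ᵐ[cellMeasure] pderiv j φ) : trilinear v d e = 0 := by
  have hs := hφ.norm_sq
  have hgc : Continuous (gradient fun x => ‖φ x‖ ^ 2) :=
    (InnerProductSpace.toDual ℝ Plane).symm.continuous.comp
      (hs.contDiff.continuous_fderiv (by simp))
  have h0 := inner_eq_zero_of_mem_H hv (w := ofContinuous _ hgc)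
    (Or.inr ⟨_, isPeriodicSmooth_iff.1 hs, coeFn_ofContinuous hgc⟩)
  rw [L2.inner_def] at h0
  have h1 : ∫ x, ⟪(ofContinuous _ hgc : L2Field) x, v x⟫ ∂cellMeasure =
      2 * trilinear v d e := by
    unfold trilinear
    rw [← integral_const_mul]
    refine integral_congr_ae ?_
    filter_upwards [coeFn_ofContinuous hgc, he, hd 0, hd 1] with x h1 h2 h3 h4
    rw [h1, inner_gradient, h2]
    simp only [transport, Fin.sum_univ_two]
    rw [h3, h4, pderiv_norm_sq hφ.differentiable, pderiv_norm_sq hφ.differentiable,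
      inner_add_left, real_inner_smul_left, real_inner_smul_left,
      real_inner_comm (pderiv 0 φ x), real_inner_comm (pderiv 1 φ x)]
    ring
  linarith

/-- The smooth case is applied to the truncations of `w`. The trilinear form passes to the limit
because it is controlled by `L²` norms of the derivatives and `L⁴` norms of the fields, and
Ladyzhenskaya's inequality turns `L²` convergence of the truncations with bounded gradients into
`L⁴` convergence. -/
lemma trilinear_self_eq_zero {v w : L2Field} (hv : v ∈ H) (hv4 : MemLp v 4 cellMeasure)
    {d : Fin 2 → L2Field} (hd : ∀ j, IsWeakPartial j w (d j)) : trilinear v d w = 0 := by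
  have hdK : ∀ (K : ℕ) j, IsWeakPartial j (sqProj K w) (sqProj K (d j)) := fun K j =>
    (hd j).map_lowProj _
  have hw4 := memLp_four hd
  have hK : ∀ K : ℕ, trilinear v (fun j => sqProj K (d j)) (sqProj K w) = 0 := by
    intro K
    obtain ⟨φ, hφ, heφ, h⟩ := exists_smooth_of_mem_trig (lowProj_mem_trig (Real.sqrt K) w)
    choose d' _ hd' using h
    have hdg : ∀ j, d' j = sqProj K (d j) := fun j =>
      (isWeakPartial_of_ae_eq hφ heφ (hd' j)).unique (hdK K j)
    exact trilinear_self_eq_zero_of_smooth hv hφ heφ fun j => hdg j ▸ hd' j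
  set G := ‖d 0‖ + ‖d 1‖ with hG
  have hdG : ∀ j, ‖d j‖ ≤ G := fun j => by fin_cases j <;> simp [hG]
  have hG0 : 0 ≤ G := by positivity
  set M := Real.sqrt (‖w‖ * (‖w‖ + 2 * G)) with hM
  have hMK : ∀ K : ℕ, normFour (sqProj K w) ≤ M := by
    intro K
    refine Real.le_sqrt_of_sq_le ((normFour_sq_le (hdK K) (G := G)
      fun j => (norm_lowProj_le _ _).trans (hdG j)).trans ?_)
    have h1 := norm_lowProj_le (Real.sqrt K) w
    have h0 := norm_nonneg (sqProj K w)
    gcongr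
  have hdiff : ∀ K : ℕ, normFour (sqProj K w - w) ≤
      Real.sqrt (‖sqProj K w - w‖ * (‖sqProj K w - w‖ + 2 * (2 * G))) := by
    intro K
    refine Real.le_sqrt_of_sq_le (normFour_sq_le (fun j => (hdK K j).sub (hd j)) fun j => ?_)
    have h1 := norm_lowProj_le (Real.sqrt K) (d j)
    have h2 := hdG j
    have h3 := norm_sub_le (sqProj K (d j)) (d j)
    linarith
  have hbound : ∀ K : ℕ, |trilinear v d w| ≤
      (∑ j, ‖sqProj K (d j) - d j‖) * (normFour v * M) +
      (∑ j, ‖d j‖) * (normFour v *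
        Real.sqrt (‖sqProj K w - w‖ * (‖sqProj K w - w‖ + 2 * (2 * G)))) := by
    intro K
    have hwK4 := memLp_four (hdK K)
    have e1 := trilinear_sub_middle hv4 hwK4 (fun j => sqProj K (d j)) d
    have e2 := trilinear_sub_right hv4 hwK4 hw4 d
    rw [hK] at e1
    have b1 := abs_trilinear_le hv4 hwK4 (fun j => sqProj K (d j) - d j)
    have b2 := abs_trilinear_le hv4 (memLp_four fun j => (hdK K j).sub (hd j)) d
    have e3 : trilinear v d w = -(trilinear v (fun j => sqProj K (d j) - d j) (sqProj K w)
        + trilinear v d (sqProj K w - w)) := by rw [e1, e2]; ring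
    rw [e3, abs_neg]
    refine (abs_add_le _ _).trans (add_le_add (b1.trans ?_) (b2.trans ?_))
    · exact mul_le_mul_of_nonneg_left (mul_le_mul_of_nonneg_left (hMK K) (normFour_nonneg v))
        (Finset.sum_nonneg fun _ _ => norm_nonneg _)
    · exact mul_le_mul_of_nonneg_left (mul_le_mul_of_nonneg_left (hdiff K) (normFour_nonneg v))
        (Finset.sum_nonneg fun _ _ => norm_nonneg _)
  have hz : ∀ a : L2Field, Tendsto (fun K : ℕ => ‖sqProj K a - a‖) atTop (𝓝 0) := fun a =>
    tendsto_iff_norm_sub_tendsto_zero.1 (tendsto_sqProj a)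
  have hlim : Tendsto (fun K : ℕ => (∑ j, ‖sqProj K (d j) - d j‖) * (normFour v * M) +
      (∑ j, ‖d j‖) * (normFour v *
        Real.sqrt (‖sqProj K w - w‖ * (‖sqProj K w - w‖ + 2 * (2 * G))))) atTop (𝓝 0) := by
    have t1 := ((tendsto_finsetSum Finset.univ fun j _ => hz (d j)).mul_const (normFour v * M))
    have t2 := ((((hz w).mul ((hz w).add_const (2 * (2 * G)))).sqrt.const_mul
      (normFour v)).const_mul (∑ j, ‖d j‖))
    have := t1.add t2
    simpa using this
  have h0 := ge_of_tendsto' hlim hbound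
  exact abs_eq_zero.1 (le_antisymm h0 (abs_nonneg _))

lemma inner_leray {w : L2Field} (hw : w ∈ H) (a : L2Field) : ⟪leray a, w⟫ = ⟪a, w⟫ := by
  have hw' : w ∈ (Submodule.span ℝ constantsAndGradients)ᗮ := hw
  have h := Submodule.inner_starProjection_left_eq_right
    (K := (Submodule.span ℝ constantsAndGradients)ᗮ) a w
  rw [Submodule.starProjection_eq_self_iff.2 hw'] at h
  exact h

/-- The only wavenumber with `|k| ≤ 1/2` is zero, and fields in `H` are mean-free. The spectral gap
at `N = 1/2` thereby becomes a Poincaré inequality with constant `2`. -/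
lemma lowProj_half_eq_zero {w : L2Field} (hw : w ∈ H) : lowProj (1 / 2) w = 0 := by
  symm
  refine eq_lowProj (zero_mem _) fun e he => ?_
  rw [sub_zero]
  induction he using Submodule.span_induction with
  | mem e he =>
    obtain ⟨k, c, hk, h⟩ := mem_lowModes_iff.1 he
    have hk0 : ∀ x, phase k x = 0 := by
      obtain ⟨m, hm⟩ := waveLength_sq k
      have hk0 : 0 ≤ waveLength k := Real.sqrt_nonneg _
      have h1 : (m : ℝ) < 1 := by rw [← hm]; nlinarith
      have h2 : m = 0 := by
        have : m < 1 := by exact_mod_cast h1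
        omega
      rw [h2, waveLength, Real.sq_sqrt (Finset.sum_nonneg fun _ _ => sq_nonneg _), Nat.cast_zero,
        Fin.sum_univ_two] at hm
      intro x
      have a0 : (k 0 : ℝ) = 0 := by nlinarith [sq_nonneg (k 0 : ℝ), sq_nonneg (k 1 : ℝ)]
      have a1 : (k 1 : ℝ) = 0 := by nlinarith [sq_nonneg (k 0 : ℝ), sq_nonneg (k 1 : ℝ)]
      rw [phase_apply, Fin.sum_univ_two, a0, a1]
      ring
    rw [real_inner_comm]
    refine inner_eq_zero_of_mem_H hw (Or.inl ?_)
    rcases h with rfl | rfl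
    · exact ⟨c, (coeFn_cosMode k c).trans (Eventually.of_forall fun x => by simp [hk0])⟩
    · exact ⟨0, (coeFn_sinMode k c).trans (Eventually.of_forall fun x => by simp [hk0])⟩
  | zero => simp
  | add a b _ _ ha hb => rw [inner_add_right, ha, hb, add_zero]
  | smul r a _ ha => rw [inner_smul_right, ha, mul_zero]

/-- The norm `|∇u|`. -/
noncomputable def gradNorm (u : L2Field) : ℝ := Real.sqrt (∑ j, ‖weakPartial j u‖ ^ 2)

lemma gradNorm_nonneg (u : L2Field) : 0 ≤ gradNorm u := Real.sqrt_nonneg _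

lemma gradNorm_sq (u : L2Field) : gradNorm u ^ 2 = ∑ j, ‖weakPartial j u‖ ^ 2 :=
  Real.sq_sqrt (Finset.sum_nonneg fun _ _ => sq_nonneg _)

lemma norm_weakPartial_le (u : L2Field) (j : Fin 2) : ‖weakPartial j u‖ ≤ gradNorm u :=
  Real.le_sqrt_of_sq_le (Finset.single_le_sum (f := fun j => ‖weakPartial j u‖ ^ 2)
    (fun _ _ => sq_nonneg _) (Finset.mem_univ j))

lemma isWeakPartial_of_mem_V {u : L2Field} (hu : u ∈ V) (j : Fin 2) :
    IsWeakPartial j u (weakPartial j u) :=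
  isWeakPartial_weakPartial (hu.2 j)

/-- Poincaré's inequality, with a non-optimal constant. -/
lemma norm_le_two_mul_gradNorm {u : L2Field} (hu : u ∈ V) : ‖u‖ ≤ 2 * gradNorm u := by
  have h := sq_mul_norm_sub_lowProj_le (N := 1 / 2) (by norm_num) (isWeakPartial_of_mem_V hu)
  rw [lowProj_half_eq_zero hu.1, norm_zero, ← gradNorm_sq] at h
  have := gradNorm_nonneg u
  refine abs_le_of_sq_le_sq' ?_ (by positivity) |>.2
  linarith

lemma sub_mem_V {u v : L2Field} (hu : u ∈ V) (hv : v ∈ V) : u - v ∈ V :=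
  ⟨H.sub_mem hu.1 hv.1, fun j =>
    ⟨_, (isWeakPartial_of_mem_V hu j).sub (isWeakPartial_of_mem_V hv j)⟩⟩

lemma weakPartial_sub {u v : L2Field} (hu : u ∈ V) (hv : v ∈ V) (j : Fin 2) :
    weakPartial j (u - v) = weakPartial j u - weakPartial j v :=
  ((isWeakPartial_of_mem_V hu j).sub (isWeakPartial_of_mem_V hv j)).weakPartial_eq

/-! ### Pairings with the Stokes and convection terms -/

lemma inner_stokes {u w : L2Field} (hu : u ∈ domA) (hw : w ∈ V) :
    ⟪stokes u, w⟫ = ∑ j, ⟪weakPartial j u, weakPartial j w⟫ := by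
  rw [stokes, inner_neg_left, inner_leray hw.1, sum_inner, ← Finset.sum_neg_distrib]
  refine Finset.sum_congr rfl fun j _ => ?_
  rw [(isWeakPartial_weakPartial (hu.2 j j)).inner_eq_neg_inner (isWeakPartial_of_mem_V hw j),
    neg_neg]

lemma inner_bilin {u w : L2Field} (hu : u ∈ domA) (hw : w ∈ H) :
    ⟪bilin u u, w⟫ = trilinear u (fun j => weakPartial j u) w := by
  -- For `u ∈ D(A)` both `u` and its first derivatives are in `L⁴`, so `(u · ∇)u` is in `L²` and the
  -- default value in `bilin` is not taken.
  have h : MemLp (fun x => ∑ j, u x j • weakPartial j u x) 2 cellMeasure :=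
    memLp_transport (memLp_four (isWeakPartial_of_mem_V hu.1)) fun j =>
      memLp_four fun i => isWeakPartial_weakPartial (hu.2 i j)
  rw [bilin, dif_pos h, inner_leray hw, L2.inner_def]
  refine integral_congr_ae ?_
  filter_upwards [h.coeFn_toLp] with x hx
  rw [hx]; rfl

lemma inner_bilin_self {u : L2Field} (hu : u ∈ domA) : ⟪bilin u u, u⟫ = 0 := by
  rw [inner_bilin hu hu.1.1]
  exact trilinear_self_eq_zero hu.1.1 (memLp_four (isWeakPartial_of_mem_V hu.1))
    (isWeakPartial_of_mem_V hu.1)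

/-- With `w = v - u`, `B(v,v) - B(u,u) = B(v,w) + B(w,u)`, and the first term is orthogonal to `w`.
The constant is `8 = 2 · 4`: the two derivatives of `u` give `2|∇u|`, and Ladyzhenskaya and Poincaré
give `‖w‖₄² ≤ 4|w||∇w|`. -/
lemma abs_inner_bilin_sub_le {u v : L2Field} (hu : u ∈ domA) (hv : v ∈ domA) :
    |⟪bilin v v - bilin u u, v - u⟫| ≤ 8 * (gradNorm u * ‖v - u‖ * gradNorm (v - u)) := by
  have hw := sub_mem_V hv.1 hu.1
  have hdu := isWeakPartial_of_mem_V hu.1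
  have hdv := isWeakPartial_of_mem_V hv.1
  have hdw := isWeakPartial_of_mem_V hw
  have hu4 := memLp_four hdu
  have hv4 := memLp_four hdv
  have hw4 := memLp_four hdw
  have h0 := trilinear_self_eq_zero hv.1.1 hv4 hdw
  simp_rw [weakPartial_sub hv.1 hu.1] at h0
  rw [trilinear_sub_middle hv4 hw4 (fun j => weakPartial j v) fun j => weakPartial j u] at h0
  have e : ⟪bilin v v - bilin u u, v - u⟫ =
      trilinear (v - u) (fun j => weakPartial j u) (v - u) := by
    rw [inner_sub_left, inner_bilin hv hw.1, inner_bilin hu hw.1, trilinear_sub_left hv4 hu4 hw4]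
    linarith
  rw [e]
  have h1 := abs_trilinear_le hw4 hw4 (fun j => weakPartial j u)
  have h2 := normFour_sq_le hdw (norm_weakPartial_le (v - u))
  have h3 := norm_le_two_mul_gradNorm hw
  have h4 : ∑ j, ‖weakPartial j u‖ ≤ 2 * gradNorm u := by
    rw [Fin.sum_univ_two]
    linarith [norm_weakPartial_le u 0, norm_weakPartial_le u 1]
  have h5 : ‖v - u‖ * (‖v - u‖ + 2 * gradNorm (v - u)) ≤ ‖v - u‖ * (4 * gradNorm (v - u)) :=
    mul_le_mul_of_nonneg_left (by linarith) (norm_nonneg _)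
  rw [← sq] at h1
  calc _ ≤ _ := h1
    _ ≤ 2 * gradNorm u * (‖v - u‖ * (4 * gradNorm (v - u))) :=
      mul_le_mul h4 (h2.trans h5) (sq_nonneg _) (mul_nonneg two_pos.le (gradNorm_nonneg u))
    _ = _ := by ring

/-! ### Differential inequalities for absolutely continuous functions -/

lemma absolutelyContinuousOnInterval_of_dist_le {X Y : Type*} [PseudoMetricSpace X]
    [PseudoMetricSpace Y] {f : ℝ → X} {g : ℝ → Y} {a b C : ℝ}
    (h : ∀ s ∈ Set.uIcc a b, ∀ t ∈ Set.uIcc a b, dist (f s) (f t) ≤ C * dist (g s) (g t))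
    (hg : AbsolutelyContinuousOnInterval g a b) : AbsolutelyContinuousOnInterval f a b := by
  have h0 := Tendsto.const_mul C hg
  rw [mul_zero] at h0
  refine squeeze_zero' (Eventually.of_forall fun E => Finset.sum_nonneg fun _ _ => dist_nonneg)
    ?_ h0
  have hmem : ∀ᶠ E in AbsolutelyContinuousOnInterval.totalLengthFilter ⊓
      𝓟 (AbsolutelyContinuousOnInterval.disjWithin a b),
      E ∈ AbsolutelyContinuousOnInterval.disjWithin a b :=
    mem_inf_of_right (mem_principal_self _)
  filter_upwards [hmem] with E hE
  rw [Finset.mul_sum]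
  exact Finset.sum_le_sum fun i hi => h _ (hE.1 i hi).1 _ (hE.1 i hi).2

lemma le_of_ae_hasDerivAt_nonpos {Y : ℝ → ℝ} {T : ℝ} (hT : 0 ≤ T)
    (hY : AbsolutelyContinuousOnInterval Y 0 T)
    (h : ∀ᵐ t, t ∈ Set.Ioc 0 T → ∃ D ≤ 0, HasDerivAt Y D t) : Y T ≤ Y 0 := by
  have h1 := hY.integral_deriv_eq_sub
  have h2 : ∫ t in (0 : ℝ)..T, deriv Y t ≤ 0 := by
    rw [intervalIntegral.integral_of_le hT]
    refine integral_nonpos_of_ae ((ae_restrict_iff' measurableSet_Ioc).2 ?_)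
    filter_upwards [h] with t ht hmem
    obtain ⟨D, hD, hd⟩ := ht hmem
    rw [hd.deriv]
    exact hD
  linarith

section
variable {E : Type*} [NormedAddCommGroup E] [InnerProductSpace ℝ E]
  {X X' : ℝ → E} {x₀ : E} {T : ℝ}

/-- Increments of the vector-valued primitive are dominated by those of the real primitive of
`‖X'‖`, which is absolutely continuous; squaring the norm is Lipschitz on bounded sets. -/
lemma absolutelyContinuousOnInterval_norm_sq (hX' : IntervalIntegrable X' volume 0 T) :
    AbsolutelyContinuousOnInterval (fun t => ‖x₀ + ∫ s in (0 : ℝ)..t, X' s‖ ^ 2) 0 T := by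
  have hn := hX'.norm.absolutelyContinuousOnInterval_intervalIntegral (c := 0) (by simp)
  have hI : ∀ t ∈ Set.uIcc 0 T, IntervalIntegrable X' volume 0 t := fun t ht =>
    hX'.mono_set (Set.uIcc_subset_uIcc_left ht)
  have hX : AbsolutelyContinuousOnInterval (fun t => x₀ + ∫ s in (0 : ℝ)..t, X' s) 0 T := by
    refine absolutelyContinuousOnInterval_of_dist_le (C := 1) (fun s hs t ht => ?_) hn
    rw [one_mul, dist_add_left, dist_eq_norm, dist_eq_norm,
      intervalIntegral.integral_interval_sub_left (hI s hs) (hI t ht),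
      intervalIntegral.integral_interval_sub_left (hI s hs).norm (hI t ht).norm]
    exact intervalIntegral.norm_integral_le_abs_integral_norm
  obtain ⟨M, hM⟩ := hX.exists_bound
  refine absolutelyContinuousOnInterval_of_dist_le (C := 2 * M) (fun s hs t ht => ?_) hX
  have h1 := hM s hs
  have h2 := hM t ht
  rw [Real.dist_eq, dist_eq_norm]
  set p := x₀ + ∫ s in (0 : ℝ)..s, X' s
  set q := x₀ + ∫ s in (0 : ℝ)..t, X' s
  rw [sq_sub_sq, abs_mul, abs_of_nonneg (by positivity)]
  exact mul_le_mul (by linarith) (abs_norm_sub_norm_le p q) (abs_nonneg _)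
    (by linarith [norm_nonneg p])

/-- The derivative is taken of the primitive, which is defined on all of `ℝ`, because `X` itself is
prescribed only for `t ≥ 0`. -/
lemma ae_hasDerivAt_norm_sq [CompleteSpace E] (hX' : IntervalIntegrable X' volume 0 T) (hT : 0 ≤ T)
    (hX : ∀ t, 0 ≤ t → X t = x₀ + ∫ s in (0 : ℝ)..t, X' s) :
    ∀ᵐ t, t ∈ Set.Ioc 0 T →
      HasDerivAt (fun t => ‖x₀ + ∫ s in (0 : ℝ)..t, X' s‖ ^ 2) (2 * ⟪X t, X' t⟫) t := by
  filter_upwards [hX'.ae_hasDerivAt_integral] with t ht hmem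
  have hmem' : t ∈ Set.uIcc 0 T := by
    rw [Set.uIcc_of_le hT]; exact Set.Ioc_subset_Icc_self hmem
  have h1 := ((ht hmem' 0 (by simp)).const_add x₀).norm_sq
  rwa [← hX t hmem.1.le] at h1

lemma absolutelyContinuousOnInterval_of_hasDerivAt {A a : ℝ → ℝ} (ha : Continuous a)
    (hA : ∀ t, HasDerivAt A (a t) t) (b c : ℝ) : AbsolutelyContinuousOnInterval A b c := by
  have : ContDiff ℝ 1 A := by
    rw [contDiff_one_iff_deriv]
    refine ⟨fun t => (hA t).differentiableAt, ?_⟩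
    rwa [show deriv A = a from funext fun t => (hA t).deriv]
  exact this.contDiffOn.absolutelyContinuousOnInterval

lemma norm_sq_le_add_integral [CompleteSpace E] (hX' : IntervalIntegrable X' volume 0 T) (hT : 0 ≤ T)
    (hX : ∀ t, 0 ≤ t → X t = x₀ + ∫ s in (0 : ℝ)..t, X' s) {φ : ℝ → ℝ} (hφ : Continuous φ)
    (h : ∀ᵐ t, t ∈ Set.Ioc 0 T → 2 * ⟪X t, X' t⟫ ≤ φ t) :
    ‖X T‖ ^ 2 ≤ ‖x₀‖ ^ 2 + ∫ t in (0 : ℝ)..T, φ t := by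
  have hA : ∀ t, HasDerivAt (fun t => ∫ s in (0 : ℝ)..t, φ s) (φ t) t := fun t =>
    (hφ.integral_hasStrictDerivAt 0 t).hasDerivAt
  have hac := (absolutelyContinuousOnInterval_norm_sq (x₀ := x₀) hX').sub
    (absolutelyContinuousOnInterval_of_hasDerivAt hφ hA 0 T)
  have := le_of_ae_hasDerivAt_nonpos hT hac (by
    filter_upwards [ae_hasDerivAt_norm_sq hX' hT hX, h] with t h1 h2 hmem
    exact ⟨_, sub_nonpos.2 (h2 hmem), (h1 hmem).sub (hA t)⟩)
  simp only [Pi.sub_apply, intervalIntegral.integral_same, add_zero, sub_zero] at this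
  rw [hX T hT]
  linarith

/-- Grönwall by integrating factor: `‖X t‖² exp(-∫₀ᵗ a)` is absolutely continuous with nonpositive
derivative almost everywhere. -/
lemma norm_sq_le_mul_exp [CompleteSpace E] (hX' : IntervalIntegrable X' volume 0 T) (hT : 0 ≤ T)
    (hX : ∀ t, 0 ≤ t → X t = x₀ + ∫ s in (0 : ℝ)..t, X' s) {a : ℝ → ℝ} (ha : Continuous a)
    (h : ∀ᵐ t, t ∈ Set.Ioc 0 T → 2 * ⟪X t, X' t⟫ ≤ a t * ‖X t‖ ^ 2) :
    ‖X T‖ ^ 2 ≤ ‖x₀‖ ^ 2 * Real.exp (∫ t in (0 : ℝ)..T, a t) := by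
  have hA : ∀ t, HasDerivAt (fun t => ∫ s in (0 : ℝ)..t, a s) (a t) t := fun t =>
    (ha.integral_hasStrictDerivAt 0 t).hasDerivAt
  have hE : ∀ t, HasDerivAt (fun t => Real.exp (-∫ s in (0 : ℝ)..t, a s))
      (Real.exp (-∫ s in (0 : ℝ)..t, a s) * -a t) t := fun t => (hA t).neg.exp
  have hAc : Continuous fun t => ∫ s in (0 : ℝ)..t, a s :=
    continuous_iff_continuousAt.2 fun t => (hA t).continuousAt
  have hac := (absolutelyContinuousOnInterval_norm_sq (x₀ := x₀) hX').mul
    (absolutelyContinuousOnInterval_of_hasDerivAt (by fun_prop) hE 0 T)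
  have := le_of_ae_hasDerivAt_nonpos hT hac (by
    filter_upwards [ae_hasDerivAt_norm_sq hX' hT hX, h] with t h1 h2 hmem
    refine ⟨_, ?_, (h1 hmem).mul (hE t)⟩
    rw [← hX t hmem.1.le]
    have h3 := mul_le_mul_of_nonneg_right (h2 hmem)
      (Real.exp_pos (-∫ s in (0 : ℝ)..t, a s)).le
    linarith)
  simp only [Pi.mul_apply, intervalIntegral.integral_same, add_zero, neg_zero, Real.exp_zero,
    mul_one] at this
  rw [← hX T hT, Real.exp_neg] at this
  rwa [← div_eq_mul_inv, div_le_iff₀ (Real.exp_pos _)] at this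

end

lemma intervalIntegrable_of_memLp {E : Type*} [NormedAddCommGroup E] {f : ℝ → E} {T : ℝ}
    (hT : 0 < T) (h : MemLp f 2 (volume.restrict (Set.Ioc 0 T))) :
    IntervalIntegrable f volume 0 T := by
  rw [intervalIntegrable_iff_integrableOn_Ioc_of_le hT.le]
  exact h.integrable (by norm_num)

/-! ### Energy estimates -/

lemma ae_norm_le_forceNorm {f : ℝ → L2Field} (hf : IsForce f) :
    ∀ᵐ t ∂volume.restrict (Set.Ioi (0 : ℝ)), ‖f t‖ ≤ forceNorm f := by
  have h := ae_le_eLpNormEssSup (f := f) (μ := volume.restrict (Set.Ioi (0 : ℝ)))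
  filter_upwards [h] with t ht
  rw [← eLpNorm_exponent_top] at ht
  have := ENNReal.toReal_mono hf.1.2.ne ht
  simpa [forceNorm] using this

/-- Freezing the solution at its initial value for negative times gives a coefficient continuous on
all of `ℝ`, as the integral inequalities above require. -/
lemma continuous_gradNorm_sq {ν : ℝ} {h : ℝ → L2Field} {u₀ : L2Field} {u : ℝ → L2Field}
    (hu : IsStrongSolution ν h u₀ u) : Continuous fun t => gradNorm (u (max t 0)) ^ 2 := by
  simp_rw [gradNorm_sq]
  refine continuous_finsetSum _ fun j _ => ((hu.2.2.2.1 j).comp_continuous (by fun_prop)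
    fun t => ?_).norm.pow 2
  exact le_max_right t 0

/-- The energy inequality for the Navier–Stokes equations. -/
lemma integral_gradNorm_sq_le {ν : ℝ} (hν : 0 < ν) {f : ℝ → L2Field} (hf : IsForce f)
    {u₀ : L2Field} {u : ℝ → L2Field} (hu : IsStrongSolution ν f u₀ u) {T : ℝ} (hT : 0 < T) :
    ν * ∫ t in (0 : ℝ)..T, gradNorm (u (max t 0)) ^ 2 ≤
      ‖u₀‖ ^ 2 + 4 * forceNorm f ^ 2 / ν * T := by
  have hg := continuous_gradNorm_sq hu
  obtain ⟨-, hV, -, -, hA, -, u', hu', hint, heq⟩ := hu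
  have h := norm_sq_le_add_integral (intervalIntegrable_of_memLp hT (hu' T hT)) hT.le hint
    (φ := fun t => -(ν * gradNorm (u (max t 0)) ^ 2) + 4 * forceNorm f ^ 2 / ν) (by fun_prop) (by
      rw [ae_restrict_iff' measurableSet_Ioi] at hA heq
      have hF := (ae_restrict_iff' measurableSet_Ioi).1 (ae_norm_le_forceNorm hf)
      filter_upwards [hA, heq, hF] with t h1 h2 h3 hmem
      have ht : t ∈ Set.Ioi (0 : ℝ) := hmem.1
      specialize h1 ht
      specialize h2 ht
      specialize h3 ht
      rw [max_eq_left ht.le]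
      have e : u' t = f t - ν • stokes (u t) - bilin (u t) (u t) := by rw [← h2]; abel
      have hst : ⟪stokes (u t), u t⟫ = gradNorm (u t) ^ 2 := by
        rw [inner_stokes h1 h1.1, gradNorm_sq]
        exact Finset.sum_congr rfl fun j _ => real_inner_self_eq_norm_sq _
      have hfu : ⟪f t, u t⟫ ≤ forceNorm f * (2 * gradNorm (u t)) :=
        (real_inner_le_norm _ _).trans (mul_le_mul h3 (norm_le_two_mul_gradNorm h1.1)
          (norm_nonneg _) ((norm_nonneg _).trans h3))
      rw [real_inner_comm, e, inner_sub_left, inner_sub_left, real_inner_smul_left, hst,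
        inner_bilin_self h1]
      -- Young's inequality for `2⟪f, u⟫ ≤ 4|f||∇u|`, using half of the dissipation `2ν|∇u|²`.
      have hsq : 4 * (forceNorm f * gradNorm (u t)) ≤
          ν * gradNorm (u t) ^ 2 + 4 * forceNorm f ^ 2 / ν := by
        have h5 : 0 ≤ (ν * gradNorm (u t) - 2 * forceNorm f) ^ 2 / ν := by positivity
        have h6 : (ν * gradNorm (u t) - 2 * forceNorm f) ^ 2 / ν =
            ν * gradNorm (u t) ^ 2 - 4 * (forceNorm f * gradNorm (u t)) +
              4 * forceNorm f ^ 2 / ν := by field_simp; ring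
        linarith
      linarith)
  rw [intervalIntegral.integral_add (Continuous.intervalIntegrable (by fun_prop) _ _) (by simp),
    intervalIntegral.integral_neg, intervalIntegral.integral_const_mul,
    intervalIntegral.integral_const, sub_zero, smul_eq_mul] at h
  have := sq_nonneg ‖u T‖
  linarith

/-- The difference of the two components of the nudging filter satisfies a Grönwall estimate. -/
lemma norm_sq_sub_le {ν μ N : ℝ} (hν : 0 < ν) (hN : 0 ≤ N) (hμN : 2 * μ ≤ ν * N ^ 2)
    {f : ℝ → L2Field} {v₀ u₀ : L2Field} {v u : ℝ → L2Field}
    (h : IsNudgingSolution ν μ N f v₀ u₀ v u) {T : ℝ} (hT : 0 < T) :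
    ‖v T - u T‖ ^ 2 ≤ ‖v₀ - u₀‖ ^ 2 *
      Real.exp (64 / ν * (∫ t in (0 : ℝ)..T, gradNorm (u (max t 0)) ^ 2) - 2 * μ * T) := by
  obtain ⟨hv, hu⟩ := h
  have hg := continuous_gradNorm_sq hu
  obtain ⟨-, -, -, -, hAv, -, v', hv', hintv, heqv⟩ := hv
  obtain ⟨-, -, -, -, hAu, -, u', hu', hintu, hequ⟩ := hu
  have hiv : ∀ t, 0 ≤ t → IntervalIntegrable v' volume 0 t := fun t ht => by
    rcases ht.eq_or_lt with rfl | ht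
    · simp
    · exact intervalIntegrable_of_memLp ht (hv' t ht)
  have hiu : ∀ t, 0 ≤ t → IntervalIntegrable u' volume 0 t := fun t ht => by
    rcases ht.eq_or_lt with rfl | ht
    · simp
    · exact intervalIntegrable_of_memLp ht (hu' t ht)
  have h := norm_sq_le_mul_exp (X := fun t => v t - u t) (X' := fun t => v' t - u' t)
    (x₀ := v₀ - u₀) ((hiv T hT.le).sub (hiu T hT.le)) hT.le
    (fun t ht => by
      rw [hintv t ht, hintu t ht, intervalIntegral.integral_sub (hiv t ht) (hiu t ht)]
      abel)
    (a := fun t => 64 / ν * gradNorm (u (max t 0)) ^ 2 - 2 * μ) (by fun_prop) (by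
      rw [ae_restrict_iff' measurableSet_Ioi] at hAv hAu heqv hequ
      filter_upwards [hAv, hAu, heqv, hequ] with t h1 h2 h3 h4 hmem
      have ht : t ∈ Set.Ioi (0 : ℝ) := hmem.1
      specialize h1 ht
      specialize h2 ht
      specialize h3 ht
      specialize h4 ht
      rw [max_eq_left ht.le]
      have hw := sub_mem_V h1.1 h2.1
      set w := v t - u t with hwdef
      have e : v' t - u' t = -(ν • (stokes (v t) - stokes (u t))) -
          (bilin (v t) (v t) - bilin (u t) (u t)) - μ • lowProj N w := by
        rw [hwdef, map_sub]
        have e1 : v' t = f t - μ • lowProj N (v t) + μ • lowProj N (u t) - ν • stokes (v t) -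
            bilin (v t) (v t) := by rw [← h3]; abel
        have e2 : u' t = f t - ν • stokes (u t) - bilin (u t) (u t) := by rw [← h4]; abel
        rw [e1, e2]
        module
      have hst : ⟪stokes (v t) - stokes (u t), w⟫ = gradNorm w ^ 2 := by
        rw [inner_sub_left, inner_stokes h1 hw, inner_stokes h2 hw, ← Finset.sum_sub_distrib,
          gradNorm_sq]
        refine Finset.sum_congr rfl fun j _ => ?_
        rw [← inner_sub_left, ← weakPartial_sub h1.1 h2.1, real_inner_self_eq_norm_sq]
      have hb := (abs_le.1 (abs_inner_bilin_sub_le h2 h1)).1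
      have hgap := sq_mul_norm_sub_lowProj_le hN (isWeakPartial_of_mem_V hw)
      rw [← gradNorm_sq] at hgap
      have hP : ‖lowProj N w‖ ^ 2 ≤ ‖w‖ ^ 2 :=
        pow_le_pow_left₀ (norm_nonneg _) (norm_lowProj_le N w) 2
      -- One half of the dissipation `2ν|∇w|²` extends the damping from the low modes to all of `w`;
      -- the other half is used in `hyoung`.
      have hgap2 : 2 * μ * (‖w‖ ^ 2 - ‖lowProj N w‖ ^ 2) ≤ ν * gradNorm w ^ 2 := by
        have a1 := mul_le_mul_of_nonneg_right hμN (sub_nonneg.2 hP)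
        have a2 := mul_le_mul_of_nonneg_left hgap hν.le
        linarith
      have hyoung : 16 * (gradNorm (u t) * ‖w‖ * gradNorm w) ≤
          ν * gradNorm w ^ 2 + 64 / ν * gradNorm (u t) ^ 2 * ‖w‖ ^ 2 := by
        have h5 : 0 ≤ (ν * gradNorm w - 8 * (gradNorm (u t) * ‖w‖)) ^ 2 / ν := by positivity
        have h6 : (ν * gradNorm w - 8 * (gradNorm (u t) * ‖w‖)) ^ 2 / ν =
            ν * gradNorm w ^ 2 - 16 * (gradNorm (u t) * ‖w‖ * gradNorm w) +
              64 / ν * gradNorm (u t) ^ 2 * ‖w‖ ^ 2 := by field_simp; ring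
        linarith
      rw [real_inner_comm, e, inner_sub_left, inner_sub_left, inner_neg_left,
        real_inner_smul_left, real_inner_smul_left, hst, inner_lowProj_self]
      linarith)
  rwa [intervalIntegral.integral_sub (Continuous.intervalIntegrable (by fun_prop) _ _) (by simp),
    intervalIntegral.integral_const_mul, intervalIntegral.integral_const, sub_zero, smul_eq_mul,
    mul_comm T] at h

/-- Inserting the energy inequality into the Grönwall exponent leaves the constant `64|u₀|²/ν²` plus
a term linear in `T`, whose slope `256|f|²/ν³ - 2μ` is negative by assumption. -/
lemma tendsto_norm_sub_of_isNudgingSolution {ν μ N : ℝ} (hν : 0 < ν) (hN : 0 ≤ N)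
    (hμN : 2 * μ ≤ ν * N ^ 2) {f : ℝ → L2Field} (hf : IsForce f)
    (hμ : 256 * forceNorm f ^ 2 / ν ^ 3 < 2 * μ) {v₀ u₀ : L2Field} {v u : ℝ → L2Field}
    (h : IsNudgingSolution ν μ N f v₀ u₀ v u) :
    Tendsto (fun t => ‖v t - u t‖) atTop (𝓝 0) := by
  set r := 2 * μ - 256 * forceNorm f ^ 2 / ν ^ 3 with hr
  have hr0 : 0 < r := sub_pos.2 hμ
  have hbound : ∀ T, 0 < T → ‖v T - u T‖ ^ 2 ≤
      ‖v₀ - u₀‖ ^ 2 * Real.exp (64 / ν ^ 2 * ‖u₀‖ ^ 2 - r * T) := by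
    intro T hT
    refine (norm_sq_sub_le hν hN hμN h hT).trans
      (mul_le_mul_of_nonneg_left (Real.exp_le_exp.2 ?_) (sq_nonneg _))
    have h1 := mul_le_mul_of_nonneg_left (integral_gradNorm_sq_le hν hf h.2 hT)
      (show 0 ≤ 64 / ν ^ 2 by positivity)
    have h2 : ∀ I : ℝ, 64 / ν ^ 2 * (ν * I) = 64 / ν * I := fun I => by field_simp
    have h3 : 64 / ν ^ 2 * (4 * forceNorm f ^ 2 / ν * T) =
        256 * forceNorm f ^ 2 / ν ^ 3 * T := by field_simp; ring
    rw [h2, mul_add, h3] at h1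
    rw [hr]
    linarith
  have hlim : Tendsto (fun T => ‖v₀ - u₀‖ ^ 2 * Real.exp (64 / ν ^ 2 * ‖u₀‖ ^ 2 - r * T))
      atTop (𝓝 0) := by
    have h1 : Tendsto (fun T => 64 / ν ^ 2 * ‖u₀‖ ^ 2 - r * T) atTop atBot :=
      tendsto_atBot_add_const_left _ _ (tendsto_neg_atTop_atBot.comp (tendsto_id.const_mul_atTop hr0))
    simpa using (Real.tendsto_exp_atBot.comp h1).const_mul (‖v₀ - u₀‖ ^ 2)
  have hsq : Tendsto (fun t => ‖v t - u t‖ ^ 2) atTop (𝓝 0) :=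
    squeeze_zero' (Eventually.of_forall fun t => sq_nonneg _)
      ((eventually_gt_atTop 0).mono hbound) hlim
  have := hsq.sqrt
  simpa using this

end NSE2D

/-- The synchronization of the nudging filter follows from the energy estimates alone, with
`μ_*(ν, N) = ν N² / 2` and `N_*(|f|, ν) = 1 + 16 |f| / ν²`; the self-synchronization hypothesis
is not needed. -/
theorem mainTheorem10 (S : Set ℝ) (hS : ∀ ν ∈ S, 0 < ν)
    (h : ∀ ν ∈ S, NSE2D.MutualNudgingAssistedSelfSynchronous ν) :
    NSE2D.NudgingSynchronizationProperty S := by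
  refine ⟨fun ν N => ν * N ^ 2 / 2, fun a ν => 1 + 16 * a / ν ^ 2, ?_, ?_, ?_, ?_, ?_⟩
  · intro ν hν a ha b _ hab
    have ha0 : 0 < a := ha
    have := mul_lt_mul_of_pos_left (pow_lt_pow_left₀ hab ha0.le two_ne_zero) (hS ν hν)
    simp only
    linarith
  · intro ν hν N hN
    have := hS ν hν
    positivity
  · refine continuousOn_const.add (ContinuousOn.div (by fun_prop) (by fun_prop) ?_)
    intro p hp
    exact pow_ne_zero 2 (hS p.2 hp.2).ne'
  · intro a ha ν hν
    have := hS ν hν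
    positivity
  · intro ν hν f hf N hN μ hμ v₀ _ u₀ _ v u hvu
    have hν0 := hS ν hν
    have hF : 0 ≤ NSE2D.forceNorm f := ENNReal.toReal_nonneg
    have hx : 0 ≤ 16 * NSE2D.forceNorm f / ν ^ 2 := by positivity
    obtain ⟨hμ1, hμ2⟩ := hμ
    simp only at hN hμ1 hμ2
    refine NSE2D.tendsto_norm_sub_of_isNudgingSolution hν0 (by linarith) (by linarith) hf ?_ hvu
    have h1 : 256 * NSE2D.forceNorm f ^ 2 / ν ^ 3 =
        ν * (16 * NSE2D.forceNorm f / ν ^ 2) ^ 2 := by field_simp; ring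
    -- The summand `1` in `N_*` makes the threshold strict: `2μ ≥ νN_*² > ν(16|f|/ν²)² =
    -- 256|f|²/ν³`, also when `f = 0`.
    have h2 := mul_lt_mul_of_pos_left
      (pow_lt_pow_left₀ (lt_one_add (16 * NSE2D.forceNorm f / ν ^ 2)) hx two_ne_zero) hν0
    linarith
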